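/- **Setting.** Let $n,\tau\ge 1$, $\varepsilon\ge 0$, $t_0<\dots<t_\tau$, and let $\mathcal X$ be a set of $n$ entities moving in $\mathbb R^1$ during $[t_0,t_\tau]$; the position $\sigma(t)$ of each entity $\sigma$ is continuous in $t$ and linear on each $[t_{i},t_{i+1}]$. Put $D_\sigma(t)=\max_{\psi\in\mathcal X}|\sigma(t)-\psi(t)|$. Two entities $\sigma,\psi$ are *$\varepsilon$-connected* at time $t$ if there is a sequence $\sigma=\sigma_0,\dots,\sigma_k=\psi$ of entities with $|\sigma_i(t)-\sigma_{i+1}(t)|\le\varepsilon$ for all $i$. A *trajectoid* is a function $\mathbf c:[t_0,t_\tau]\to\mathcal X$ that is a concatenation of finitely many constant pieces of positive duration (its value at a time where two pieces meet is that of one of the two pieces) such that whenever $\mathbf c$ switches from $\sigma$ to $\psi$ at time $t$, $\sigma$ and $\psi$ are $\varepsilon$-connected at time $t$. A *central trajectory* is a trajectoid that minimizes $\mathcal D(\mathbf c)=\int_{t_0}^{t_\tau}D_{\mathbf c(t)}(t)\,dt$ among all trajectoids. The *complexity* of a trajectoid is its number of vertices: the number of times that are one of $t_0,\dots,t_\tau$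 or at which it switches from one entity to another. We say that there are *no persistent ties* if there are no two distinct entities $\sigma,\psi$ and no time interval of positive length in $[t_0,t_\tau]$ throughout which $\sigma$ and $\psi$ are $\varepsilon$-connected and $D_\sigma(t)$ and $D_\psi(t)$ both equal the minimum of $D_\rho(t)$ over the entities $\rho$ that are $\varepsilon$-connected to $\sigma$ at time $t$. The entities are in *general position* if no three of them are ever at the same point at the same time and no two distinct pairs of entities are ever at distance exactly $\varepsilon$ at the same time. **Theorem.** The worst-case complexity of a central trajectory in $\mathbb R^1$ is $\Theta(\tau n^2)$. Precisely: 1. (Upper bound.) There is an absolute constant $C$ such that, for all $n,\tau\ge1$, all $\varepsilon\ge0$ and all $\mathcal X$ as above, there is a central trajectory of complexity at most $C\tau n^2$; and if there are no persistent ties, then every central trajectory has complexity at most $C\tau n^2$. 2. (Lower bound.) There are absolute constants $K$ and $N$ such that, for all $n\ge N$, $\tau\ge1$, $\varepsilon>0$ and all $t_0<\dots<t_\tau$, there is a set $\mathcal X$ of $n$ entities as above with vertex times $t_0,\dots,t_\tau$, in general position and without persistent ties, for which every central trajectory has complexity at least $\tau n^2/K$. -/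

import Mathlib

open Set Filter Topology

/-- `n` entities moving piecewise linearly in `ℝ`, all with vertices at the common times
`time 0 < … < time τ`. Only the values `pos σ t` with `time 0 ≤ t ≤ time τ` matter. The linear pieces
live on closed intervals that share their end points, so the motion is continuous there. -/
structure MovingEntities (n τ : ℕ) where
  time : Fin (τ + 1) → ℝ
  time_strictMono : StrictMono time
  pos : Fin n → ℝ → ℝ
  linear_on_pieces : ∀ (σ : Fin n) (i : Fin τ), ∃ a b : ℝ,
    ∀ t ∈ Icc (time i.castSucc) (time i.succ), pos σ t = a + b * t

namespace MovingEntities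

variable {n τ : ℕ}

/-- The start time `t_0`. -/
def start (X : MovingEntities n τ) : ℝ := X.time 0

/-- The final time `t_τ`. -/
def finish (X : MovingEntities n τ) : ℝ := X.time (Fin.last τ)

/-- `D_σ(t)`: the distance at time `t` from `σ` to the entity farthest away from `σ`. -/
noncomputable def farDist (X : MovingEntities n τ) (σ : Fin n) (t : ℝ) : ℝ :=
  ⨆ ψ : Fin n, |X.pos σ t - X.pos ψ t|

/-- `σ` and `ψ` are `ε`-connected at time `t`: a sequence of entities leads from `σ` to `ψ` in which
consecutive entities are within distance `ε` at time `t`. -/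
def EpsConnected (X : MovingEntities n τ) (ε t : ℝ) (σ ψ : Fin n) : Prop :=
  Relation.ReflTransGen (fun ρ ρ' : Fin n => |X.pos ρ t - X.pos ρ' t| ≤ ε) σ ψ

/-- A trajectoid: a function from `[t_0, t_τ]` to the entities which is a concatenation of pieces of
positive duration (it has one-sided limits, and at every time its value is one of them), and which
only jumps, at a time `t`, between entities that are `ε`-connected at time `t`.
Values of `c` outside `[t_0, t_τ]` are irrelevant. -/
def IsTrajectoid (X : MovingEntities n τ) (ε : ℝ) (c : ℝ → Fin n) : Prop :=
  (∀ᶠ s in 𝓝[>] X.start, c s = c X.start) ∧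
  (∀ᶠ s in 𝓝[<] X.finish, c s = c X.finish) ∧
  ∀ t ∈ Ioo X.start X.finish, ∃ σ ψ : Fin n,
    (∀ᶠ s in 𝓝[<] t, c s = σ) ∧ (∀ᶠ s in 𝓝[>] t, c s = ψ) ∧
    (c t = σ ∨ c t = ψ) ∧ X.EpsConnected ε t σ ψ

/-- The cost `∫_{t_0}^{t_τ} D(c, t) dt` of a trajectoid. -/
noncomputable def cost (X : MovingEntities n τ) (c : ℝ → Fin n) : ℝ :=
  ∫ t in X.start..X.finish, X.farDist (c t) t

/-- A central trajectory: a trajectoid of minimum cost. -/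
def IsCentral (X : MovingEntities n τ) (ε : ℝ) (c : ℝ → Fin n) : Prop :=
  X.IsTrajectoid ε c ∧ ∀ c' : ℝ → Fin n, X.IsTrajectoid ε c' → X.cost c ≤ X.cost c'

/-- The times at which `c` switches from one entity to another. -/
def jumpTimes (X : MovingEntities n τ) (c : ℝ → Fin n) : Set ℝ :=
  {t ∈ Ioo X.start X.finish | ¬ ∀ᶠ s in 𝓝 t, c s = c t}

/-- The complexity of `c`: the number of its vertices, that is, of the vertex times of the input
together with the times at which `c` switches from one entity to another. -/
noncomputable def complexity (X : MovingEntities n τ) (c : ℝ → Fin n) : ℕ∞ :=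
  (range X.time ∪ X.jumpTimes c).encard

/-- At time `t`, the entity `σ` is a most central one in its `ε`-connected component: `D_σ` is on the
lower envelope of the functions `D_ψ` of the entities `ψ` that are `ε`-connected to `σ`. -/
def OnEnvelope (X : MovingEntities n τ) (ε t : ℝ) (σ : Fin n) : Prop :=
  ∀ ψ : Fin n, X.EpsConnected ε t σ ψ → X.farDist σ t ≤ X.farDist ψ t

/-- No two different entities are, during a whole time interval of positive length, `ε`-connected and
both most central in their component: the lower envelopes have isolated break points only. -/
def NoPersistentTies (X : MovingEntities n τ) (ε : ℝ) : Prop :=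
  ∀ σ ψ : Fin n, σ ≠ ψ → ∀ u v : ℝ, X.start ≤ u → u < v → v ≤ X.finish →
    ∃ t ∈ Icc u v,
      ¬ (X.EpsConnected ε t σ ψ ∧ X.OnEnvelope ε t σ ∧ X.OnEnvelope ε t ψ)

/-- General position: no three trajectories meet in a point, and no two pairs of entities are at
distance exactly `ε` at the same time. -/
def GeneralPosition (X : MovingEntities n τ) (ε : ℝ) : Prop :=
  (∀ t ∈ Icc X.start X.finish, ∀ σ ψ ρ : Fin n, σ ≠ ψ → ψ ≠ ρ → σ ≠ ρ →
    ¬ (X.pos σ t = X.pos ψ t ∧ X.pos ψ t = X.pos ρ t)) ∧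
  (∀ t ∈ Icc X.start X.finish, ∀ σ ψ σ' ψ' : Fin n, σ ≠ ψ → σ' ≠ ψ' →
    |X.pos σ t - X.pos ψ t| = ε → |X.pos σ' t - X.pos ψ' t| = ε →
    s(σ, ψ) = s(σ', ψ'))

end MovingEntities

/-!
The farthest entity from `σ` is the topmost or the bottommost one, so `D_σ` measures the distance
from `σ` to the midpoint `m` between these two.

*Upper bound.* All events are organized by `CutInto P a b k`: at most `k` points cut `[a, b]` into
intervals satisfying `P`. Conditions that hold during an interval of times cost two points each, and
cuts can be refined (`CutInto.refine`). While the motion is affine, `O(n)` points fix the topmost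
and the bottommost entity; on each of the resulting intervals each entity crosses `m` at most once,
which makes `O(n²)` points; another `O(n²)` fix the order and the `ε`-proximity graph. After that, a
component on one side of `m` keeps its best entity, and every component with entities on both sides
contains the entity next to `m` from above and the one next to `m` from below, so that one more
event decides which of the two is best (`exists_best_of_fixed`). Hence `O(τ n²)` points cut the time
into intervals with constant components, each of which has an entity that stays best
(`cutInto_steady`). Every trajectoid can be rerouted to these entities
(`IsTrajectoid.exists_followsBest`) without increasing its cost. Up to finitely many times there are
only finitely many trajectoids that are constant between the cuts, so one of them is central; and
without persistent ties every central trajectory is one of them.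

*Lower bound.* Let `p` lines be tangent to the parabola `s²` at the even numbers `2 i`, and `p` lines
be tangent to `-s²` at the odd numbers `2 j + 1`. The upper envelope of the former is
`s² - dist(s, 2ℤ)²`, and similarly for the latter, so that `2 m = dist(s, 2ℤ + 1)² - dist(s, 2ℤ)²`,
which is a zigzag between `1` and `-1`. Pushing the two families far up and far down changes nothing
about `m`, and then `m` sweeps `p` times over `k` almost horizontal lines in the middle. These are
within distance `ε` of each other and better than all others, so a central trajectory follows the
one nearest to `m` (`IsZigzagMotion.eventually_eq_mid`) and jumps `p (k - 1)` times. Running back and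
forth through this motion repeats it in each time interval. The slopes are chosen such that no
persistent ties are possible, and small vertical shifts give general position
(`exists_shift_generalPosition`).
-/

/-! ### Cutting an interval of times -/

/-- At most `k` points cut `[a, b]` in such a way that every open interval `(u, v)` with end points
in `[a, b]` that contains none of them satisfies `P u v`. -/
def CutInto (P : ℝ → ℝ → Prop) (a b : ℝ) (k : ℕ) : Prop :=
  ∃ G : Finset ℝ, G.card ≤ k ∧ ∀ u v, a ≤ u → u < v → v ≤ b →
    (∀ g ∈ G, g ∉ Ioo u v) → P u v

namespace CutInto

variable {P Q : ℝ → ℝ → Prop} {a b : ℝ} {k l : ℕ}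

theorem mono (h : CutInto P a b k) (hkl : k ≤ l)
    (hPQ : ∀ u v, a ≤ u → u < v → v ≤ b → P u v → Q u v) : CutInto Q a b l := by
  obtain ⟨G, hG, hP⟩ := h
  exact ⟨G, hG.trans hkl, fun u v hu huv hv hg => hPQ u v hu huv hv (hP u v hu huv hv hg)⟩

theorem of_forall (h : ∀ u v, a ≤ u → u < v → v ≤ b → P u v) : CutInto P a b 0 :=
  ⟨∅, by simp, fun u v hu huv hv _ => h u v hu huv hv⟩

theorem and (h : CutInto P a b k) (h' : CutInto Q a b l) :
    CutInto (fun u v => P u v ∧ Q u v) a b (k + l) := by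
  classical
  obtain ⟨G, hG, hP⟩ := h
  obtain ⟨G', hG', hQ⟩ := h'
  refine ⟨G ∪ G', (Finset.card_union_le _ _).trans (by omega), fun u v hu huv hv hg => ⟨?_, ?_⟩⟩
  · exact hP u v hu huv hv fun g h => hg g (Finset.mem_union_left _ h)
  · exact hQ u v hu huv hv fun g h => hg g (Finset.mem_union_right _ h)

theorem forall_fintype {ι : Type*} [Fintype ι] {R : ι → ℝ → ℝ → Prop}
    (h : ∀ i, CutInto (R i) a b k) :
    CutInto (fun u v => ∀ i, R i u v) a b (Fintype.card ι * k) := by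
  classical
  choose G hG hR using h
  refine ⟨Finset.univ.biUnion G, ?_, fun u v hu huv hv hg i => ?_⟩
  · exact Finset.card_biUnion_le_card_mul _ _ _ fun i _ => hG i
  · exact hR i u v hu huv hv fun g h => hg g (Finset.mem_biUnion.2 ⟨i, Finset.mem_univ _, h⟩)

/-- Cutting each of the at most `k + 1` intervals of a first cut by at most `l` further points. -/
theorem refine (h : CutInto P a b k)
    (h' : ∀ u v, a ≤ u → u < v → v ≤ b → P u v → CutInto Q u v l) :
    CutInto Q a b (k + (k + 1) * l) := by
  classical
  obtain ⟨G, hG, hP⟩ := h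
  induction k using Nat.strong_induction_on generalizing a b G with
  | _ k ih =>
  rcases le_or_gt b a with hba | hab
  · exact ⟨∅, by simp, fun u v hu huv hv _ => by linarith⟩
  by_cases hx : ∃ x ∈ G, x ∈ Ioo a b
  · obtain ⟨x, hxG, hax, hxb⟩ := hx
    set G₁ := G.filter (· < x) with hG₁
    set G₂ := G.filter (x < ·) with hG₂
    have hcard : G₁.card + G₂.card + 1 ≤ k := by
      have hd : Disjoint G₁ G₂ := by
        rw [Finset.disjoint_left]
        intro y hy hy'
        simp only [hG₁, hG₂, Finset.mem_filter] at hy hy'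
        linarith [hy.2, hy'.2]
      have hsub : insert x (G₁ ∪ G₂) ⊆ G := by
        intro y hy
        simp only [hG₁, hG₂, Finset.mem_insert, Finset.mem_union, Finset.mem_filter] at hy
        rcases hy with rfl | hy | hy
        exacts [hxG, hy.1, hy.1]
      have := Finset.card_le_card hsub
      rw [Finset.card_insert_of_notMem (by simp [hG₁, hG₂]), Finset.card_union_of_disjoint hd] at this
      omega
    obtain ⟨F₁, hF₁, hQ₁⟩ := ih G₁.card (by omega) (a := a) (b := x)
      (fun u v hu huv hv => h' u v hu huv (hv.trans hxb.le)) G₁ le_rfl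
      (fun u v hu huv hv hg => hP u v hu huv (hv.trans hxb.le) fun g hgG hguv =>
        hg g (by simp only [hG₁, Finset.mem_filter]; exact ⟨hgG, by linarith [hguv.2]⟩) hguv)
    obtain ⟨F₂, hF₂, hQ₂⟩ := ih G₂.card (by omega) (a := x) (b := b)
      (fun u v hu huv hv => h' u v (hax.le.trans hu) huv hv) G₂ le_rfl
      (fun u v hu huv hv hg => hP u v (hax.le.trans hu) huv hv fun g hgG hguv =>
        hg g (by simp only [hG₂, Finset.mem_filter]; exact ⟨hgG, by linarith [hguv.1]⟩) hguv)
    refine ⟨insert x (F₁ ∪ F₂), ?_, fun u v hu huv hv hg => ?_⟩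
    · have h1 := Finset.card_insert_le x (F₁ ∪ F₂)
      have h2 := Finset.card_union_le F₁ F₂
      have h3 : (G₁.card + G₂.card + 1 + 1) * l ≤ (k + 1) * l := Nat.mul_le_mul_right _ (by omega)
      have h4 : (G₁.card + G₂.card + 1 + 1) * l = (G₁.card + 1) * l + (G₂.card + 1) * l := by ring
      omega
    · have hxuv := hg x (Finset.mem_insert_self _ _)
      rcases le_or_gt v x with hvx | hvx
      · exact hQ₁ u v hu huv hvx fun g h => hg g (by simp [h])
      · have hxu : x ≤ u := by
          by_contra hlt
          exact hxuv ⟨not_le.1 hlt, hvx⟩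
        exact hQ₂ u v hxu huv hv fun g h => hg g (by simp [h])
  · push Not at hx
    obtain ⟨F, hF, hQ⟩ := h' a b le_rfl hab le_rfl (hP a b le_rfl hab le_rfl hx)
    refine ⟨F, hF.trans ?_, hQ⟩
    nlinarith

/-- The two end points of an interval `S` decide membership in `S`. -/
theorem of_ordConnected (S : Set ℝ) (hS : S.OrdConnected) (a b : ℝ) :
    CutInto (fun u v => (∀ t ∈ Ioo u v, t ∈ S) ∨ ∀ t ∈ Ioo u v, t ∉ S) a b 2 := by
  classical
  refine ⟨{sInf (S ∩ Icc a b), sSup (S ∩ Icc a b)}, Finset.card_le_two, ?_⟩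
  intro u v hu huv hv hg
  have hbb : BddBelow (S ∩ Icc a b) := bddBelow_Icc.mono inter_subset_right
  have hba : BddAbove (S ∩ Icc a b) := bddAbove_Icc.mono inter_subset_right
  by_contra! hcon
  obtain ⟨⟨t', ht', ht'S⟩, t, ht, htS⟩ := hcon
  have htm : t ∈ S ∩ Icc a b := ⟨htS, hu.trans ht.1.le, ht.2.le.trans hv⟩
  rcases lt_or_ge t t' with h | h
  · refine hg (sSup (S ∩ Icc a b)) (by simp) ⟨ht.1.trans_le (le_csSup hba htm), ?_⟩
    refine lt_of_le_of_lt (csSup_le ⟨t, htm⟩ fun y hy => ?_) ht'.2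
    by_contra hlt
    exact ht'S (hS.out htS hy.1 ⟨h.le, (not_le.1 hlt).le⟩)
  · refine hg (sInf (S ∩ Icc a b)) (by simp) ⟨?_, (csInf_le hbb htm).trans_lt ht.2⟩
    refine lt_of_lt_of_le ht'.1 (le_csInf ⟨t, htm⟩ fun y hy => ?_)
    by_contra hlt
    exact ht'S (hS.out hy.1 htS ⟨(not_le.1 hlt).le, h⟩)

end CutInto

theorem ordConnected_affine_nonneg (α β : ℝ) : {t : ℝ | 0 ≤ α + β * t}.OrdConnected := by
  refine ⟨fun x hx z hz y hy => ?_⟩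
  simp only [mem_ofPred_eq] at *
  rcases le_total 0 β with h | h
  · nlinarith [hy.1]
  · nlinarith [hy.2]

namespace MovingEntities

variable {n τ : ℕ} (X : MovingEntities n τ)

/-! ### Farthest distances and connectedness at a fixed time -/

section Static

variable {X} {ε t : ℝ}

theorem abs_le_farDist (σ ψ : Fin n) : |X.pos σ t - X.pos ψ t| ≤ X.farDist σ t :=
  le_ciSup (f := fun ψ => |X.pos σ t - X.pos ψ t|) (finite_range _).bddAbove ψ

theorem farDist_le {σ : Fin n} {r : ℝ} (h : ∀ ψ, |X.pos σ t - X.pos ψ t| ≤ r) :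
    X.farDist σ t ≤ r :=
  haveI : Nonempty (Fin n) := ⟨σ⟩
  ciSup_le h

/-- The farthest entity is the topmost one `p` or the bottommost one `q`. -/
theorem farDist_eq_max {p q : Fin n} (hp : ∀ ρ, X.pos ρ t ≤ X.pos p t)
    (hq : ∀ ρ, X.pos q t ≤ X.pos ρ t) (σ : Fin n) :
    X.farDist σ t = max (X.pos p t - X.pos σ t) (X.pos σ t - X.pos q t) := by
  apply le_antisymm
  · refine farDist_le fun ψ => abs_le'.2 ⟨?_, ?_⟩
    · exact le_max_of_le_right (by linarith [hq ψ])
    · exact le_max_of_le_left (by linarith [hp ψ])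
  · refine max_le ?_ ?_
    · exact le_trans (by rw [abs_sub_comm]; exact le_abs_self _) (abs_le_farDist σ p)
    · exact le_trans (le_abs_self _) (abs_le_farDist σ q)

theorem EpsConnected.symm {σ ψ : Fin n} (h : X.EpsConnected ε t σ ψ) : X.EpsConnected ε t ψ σ := by
  induction h with
  | refl => exact Relation.ReflTransGen.refl
  | tail _ hbc ih => exact Relation.ReflTransGen.head (by rwa [abs_sub_comm]) ih

theorem EpsConnected.trans {σ ψ ρ : Fin n} (h : X.EpsConnected ε t σ ψ)
    (h' : X.EpsConnected ε t ψ ρ) : X.EpsConnected ε t σ ρ :=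
  Relation.ReflTransGen.trans h h'

theorem EpsConnected.refl (σ : Fin n) : X.EpsConnected ε t σ σ := Relation.ReflTransGen.refl

theorem EpsConnected.single {σ ψ : Fin n} (h : |X.pos σ t - X.pos ψ t| ≤ ε) :
    X.EpsConnected ε t σ ψ := Relation.ReflTransGen.single h

/-- A chain that leaves a set of entities does so in one of its steps. -/
theorem EpsConnected.exists_step {σ ψ : Fin n} (h : X.EpsConnected ε t σ ψ) (S : Fin n → Prop)
    (hσ : S σ) (hψ : ¬ S ψ) : ∃ r r', X.EpsConnected ε t σ r ∧ |X.pos r t - X.pos r' t| ≤ ε ∧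
      S r ∧ ¬ S r' := by
  induction h with
  | refl => exact absurd hσ hψ
  | @tail b c hb hbc ih =>
    by_cases hS : S b
    · exact ⟨b, c, hb, hbc, hS, hψ⟩
    · exact ih hS

end Static

/-! ### Events during an affine motion -/

/-- The positions agree on `[a, b]` with affine functions of time. -/
def AffineOn (a b : ℝ) : Prop :=
  ∃ α β : Fin n → ℝ, ∀ σ, ∀ t ∈ Icc a b, X.pos σ t = α σ + β σ * t

/-- During `(u, v)` the `ε`-proximity graph does not change, and each of its components has an
entity that stays most central in it. -/
def Steady (ε u v : ℝ) : Prop :=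
  (∀ σ ψ, (∀ t ∈ Ioo u v, |X.pos σ t - X.pos ψ t| ≤ ε) ∨
    ∀ t ∈ Ioo u v, ¬ |X.pos σ t - X.pos ψ t| ≤ ε) ∧
  ∀ σ, ∃ ψ, ∀ t ∈ Ioo u v, X.EpsConnected ε t σ ψ ∧
    ∀ ρ, X.EpsConnected ε t σ ρ → X.farDist ψ t ≤ X.farDist ρ t

variable {X}

theorem AffineOn.mono {a b u v : ℝ} (h : X.AffineOn a b) (hu : a ≤ u) (hv : v ≤ b) :
    X.AffineOn u v := by
  obtain ⟨α, β, h⟩ := h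
  exact ⟨α, β, fun σ t ht => h σ t ⟨hu.trans ht.1, ht.2.trans hv⟩⟩

/-- Two points decide the sign of an affine function. -/
theorem cutInto_sign {a b : ℝ} {g : ℝ → ℝ} (h : ∃ α β : ℝ, ∀ t ∈ Icc a b, g t = α + β * t) :
    CutInto (fun u v => (∀ t ∈ Ioo u v, 0 ≤ g t) ∨ ∀ t ∈ Ioo u v, ¬ 0 ≤ g t) a b 2 := by
  obtain ⟨α, β, h⟩ := h
  refine (CutInto.of_ordConnected _ (ordConnected_affine_nonneg α β) a b).mono le_rfl ?_
  intro u v hu huv hv hP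
  have key : ∀ t ∈ Ioo u v, g t = α + β * t :=
    fun t ht => h t ⟨hu.trans ht.1.le, ht.2.le.trans hv⟩
  exact hP.imp (fun H t ht => by rw [key t ht]; exact H t ht)
    (fun H t ht => by rw [key t ht]; exact H t ht)

variable {a b ε : ℝ}

theorem cutInto_order (h : X.AffineOn a b) :
    CutInto (fun u v => ∀ σ ψ, (∀ t ∈ Ioo u v, X.pos σ t ≤ X.pos ψ t) ∨
      ∀ t ∈ Ioo u v, ¬ X.pos σ t ≤ X.pos ψ t) a b (n * (n * 2)) := by
  obtain ⟨α, β, h⟩ := h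
  have := CutInto.forall_fintype fun σ : Fin n => CutInto.forall_fintype fun ψ : Fin n =>
    cutInto_sign (a := a) (b := b) (g := fun t => X.pos ψ t - X.pos σ t)
      ⟨α ψ - α σ, β ψ - β σ, fun t ht => by rw [h ψ t ht, h σ t ht]; ring⟩
  simpa only [Fintype.card_fin, sub_nonneg] using this

theorem cutInto_proximity (h : X.AffineOn a b) :
    CutInto (fun u v => ∀ σ ψ, (∀ t ∈ Ioo u v, |X.pos σ t - X.pos ψ t| ≤ ε) ∨
      ∀ t ∈ Ioo u v, ¬ |X.pos σ t - X.pos ψ t| ≤ ε) a b (n * (n * 2)) := by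
  obtain ⟨α, β, h⟩ := h
  have := CutInto.forall_fintype fun σ : Fin n => CutInto.forall_fintype fun ψ : Fin n =>
    CutInto.of_ordConnected
      ({t | 0 ≤ ε - (α σ - α ψ) + -(β σ - β ψ) * t} ∩ {t | 0 ≤ ε + (α σ - α ψ) + (β σ - β ψ) * t})
      ((ordConnected_affine_nonneg _ _).inter (ordConnected_affine_nonneg _ _)) a b
  simp only [Fintype.card_fin] at this
  refine this.mono le_rfl fun u v hu huv hv H σ ψ => ?_
  have key : ∀ t ∈ Ioo u v, (|X.pos σ t - X.pos ψ t| ≤ ε ↔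
      t ∈ {t | 0 ≤ ε - (α σ - α ψ) + -(β σ - β ψ) * t} ∩
        {t | 0 ≤ ε + (α σ - α ψ) + (β σ - β ψ) * t}) := by
    intro t ht
    have ht' : t ∈ Icc a b := ⟨hu.trans ht.1.le, ht.2.le.trans hv⟩
    rw [h σ t ht', h ψ t ht', abs_le, mem_inter_iff, mem_ofPred_eq, mem_ofPred_eq]
    constructor
    · rintro ⟨h1, h2⟩
      constructor <;> linarith
    · rintro ⟨h1, h2⟩
      constructor <;> linarith
  exact (H σ ψ).imp (fun H t ht => (key t ht).2 (H t ht)) (fun H t ht => mt (key t ht).1 (H t ht))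

/-- Each entity is the topmost one during an interval of times, so `2n` points fix the topmost. -/
theorem cutInto_top [Nonempty (Fin n)] (h : X.AffineOn a b) :
    CutInto (fun u v => ∃ p, ∀ t ∈ Ioo u v, ∀ ρ, X.pos ρ t ≤ X.pos p t) a b (n * 2) := by
  obtain ⟨α, β, h⟩ := h
  have := CutInto.forall_fintype fun p : Fin n =>
    CutInto.of_ordConnected (⋂ ρ, {t | 0 ≤ (α p - α ρ) + (β p - β ρ) * t})
      (ordConnected_iInter fun _ => ordConnected_affine_nonneg _ _) a b
  rw [Fintype.card_fin] at this
  refine this.mono le_rfl fun u v hu huv hv H => ?_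
  have key : ∀ t ∈ Ioo u v, ∀ p, ((∀ ρ, X.pos ρ t ≤ X.pos p t) ↔
      t ∈ ⋂ ρ, {t | 0 ≤ (α p - α ρ) + (β p - β ρ) * t}) := by
    intro t ht p
    have ht' : t ∈ Icc a b := ⟨hu.trans ht.1.le, ht.2.le.trans hv⟩
    rw [mem_iInter]
    refine forall_congr' fun ρ => ?_
    rw [h p t ht', h ρ t ht', mem_ofPred_eq]
    constructor <;> intro <;> linarith
  have hmid : (u + v) / 2 ∈ Ioo u v := ⟨by linarith, by linarith⟩
  obtain ⟨p, hp⟩ := Finite.exists_max fun ρ => X.pos ρ ((u + v) / 2)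
  refine ⟨p, fun t ht => (key t ht p).2 ?_⟩
  rcases H p with H | H
  · exact H t ht
  · exact absurd ((key _ hmid p).1 hp) (H _ hmid)

theorem cutInto_bottom [Nonempty (Fin n)] (h : X.AffineOn a b) :
    CutInto (fun u v => ∃ q, ∀ t ∈ Ioo u v, ∀ ρ, X.pos q t ≤ X.pos ρ t) a b (n * 2) := by
  obtain ⟨α, β, h⟩ := h
  let Y : MovingEntities n τ :=
    { time := X.time
      time_strictMono := X.time_strictMono
      pos := fun σ t => - X.pos σ t
      linear_on_pieces := fun σ i => by
        obtain ⟨c, d, hcd⟩ := X.linear_on_pieces σ i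
        exact ⟨-c, -d, fun t ht => by rw [hcd t ht]; ring⟩ }
  have hY : Y.AffineOn a b :=
    ⟨fun σ => -α σ, fun σ => -β σ, fun σ t ht => by
      change - X.pos σ t = _
      rw [h σ t ht]; ring⟩
  refine (cutInto_top hY).mono le_rfl fun u v _ _ _ ⟨q, hq⟩ => ⟨q, fun t ht ρ => ?_⟩
  exact neg_le_neg_iff.1 (hq t ht ρ)

/-- The combinatorial situation during `(u, v)`: the topmost entity `p` and the bottommost entity
`q` do not change, and no entity crosses the midpoint between them. -/
def FixedSides (X : MovingEntities n τ) (p q : Fin n) (u v : ℝ) : Prop :=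
  (∀ t ∈ Ioo u v, ∀ ρ, X.pos ρ t ≤ X.pos p t) ∧ (∀ t ∈ Ioo u v, ∀ ρ, X.pos q t ≤ X.pos ρ t) ∧
  ∀ σ, (∀ t ∈ Ioo u v, 0 ≤ 2 * X.pos σ t - (X.pos p t + X.pos q t)) ∨
    ∀ t ∈ Ioo u v, ¬ 0 ≤ 2 * X.pos σ t - (X.pos p t + X.pos q t)

theorem cutInto_fixedSides [Nonempty (Fin n)] (h : X.AffineOn a b) :
    CutInto (fun u v => ∃ p q, X.FixedSides p q u v) a b
      (n * 2 + n * 2 + (n * 2 + n * 2 + 1) * (n * 2)) := by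
  refine ((cutInto_top h).and (cutInto_bottom h)).refine ?_
  rintro u v hu huv hv ⟨⟨p, hp⟩, ⟨q, hq⟩⟩
  obtain ⟨α, β, h⟩ := h
  have := CutInto.forall_fintype fun σ : Fin n =>
    cutInto_sign (a := u) (b := v) (g := fun t => 2 * X.pos σ t - (X.pos p t + X.pos q t))
      ⟨2 * α σ - (α p + α q), 2 * β σ - (β p + β q), fun t ht => by
        have ht' : t ∈ Icc a b := ⟨hu.trans ht.1, ht.2.trans hv⟩
        rw [h p t ht', h q t ht', h σ t ht']; ring⟩
  rw [Fintype.card_fin] at this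
  refine this.mono le_rfl fun u' v' hu' _ hv' H => ⟨p, q, ?_, ?_, H⟩
  · exact fun t ht => hp t ⟨hu'.trans_lt ht.1, ht.2.trans_le hv'⟩
  · exact fun t ht => hq t ⟨hu'.trans_lt ht.1, ht.2.trans_le hv'⟩

end MovingEntities

namespace MovingEntities

variable {n τ : ℕ} {X : MovingEntities n τ} {ε a b u v : ℝ}

/-! ### The best entity of a component -/

/-- The order of any two entities does not change during `(u, v)`. -/
def FixedOrder (X : MovingEntities n τ) (u v : ℝ) : Prop :=
  ∀ σ ψ, (∀ t ∈ Ioo u v, X.pos σ t ≤ X.pos ψ t) ∨ ∀ t ∈ Ioo u v, ¬ X.pos σ t ≤ X.pos ψ t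

/-- The `ε`-proximity graph does not change during `(u, v)`. -/
def FixedProximity (X : MovingEntities n τ) (ε u v : ℝ) : Prop :=
  ∀ σ ψ, (∀ t ∈ Ioo u v, |X.pos σ t - X.pos ψ t| ≤ ε) ∨
    ∀ t ∈ Ioo u v, ¬ |X.pos σ t - X.pos ψ t| ≤ ε

theorem FixedOrder.le (h : X.FixedOrder u v) {σ ψ : Fin n} {t s : ℝ} (ht : t ∈ Ioo u v)
    (hs : s ∈ Ioo u v) (hle : X.pos σ t ≤ X.pos ψ t) : X.pos σ s ≤ X.pos ψ s :=
  (h σ ψ).elim (fun H => H s hs) fun H => absurd hle (H t ht)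

theorem FixedProximity.connected (h : X.FixedProximity ε u v) {σ ψ : Fin n} {t s : ℝ}
    (ht : t ∈ Ioo u v) (hs : s ∈ Ioo u v) (hc : X.EpsConnected ε t σ ψ) :
    X.EpsConnected ε s σ ψ :=
  Relation.ReflTransGen.mono
    (fun ρ ρ' hr => (h ρ ρ').elim (fun H => H s hs) fun H => absurd hr (H t ht)) _ _ hc

/-- Inside a component that lies on one side of the midpoint `m` between top and bottom, the entity
next to `m` is most central; a component with entities on both sides contains the entity `s` next
to `m` from above and the entity `d` next to `m` from below, and one of these is most central. -/
theorem exists_best_of_fixed {p q : Fin n} (hS : X.FixedSides p q u v) (hO : X.FixedOrder u v)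
    (hP : X.FixedProximity ε u v) (huv : u < v)
    (hmix : (∃ σ, ∀ t ∈ Ioo u v, 0 ≤ 2 * X.pos σ t - (X.pos p t + X.pos q t)) →
      (∃ σ, ∀ t ∈ Ioo u v, ¬ 0 ≤ 2 * X.pos σ t - (X.pos p t + X.pos q t)) →
      ∃ s d, (∀ t ∈ Ioo u v,
        0 ≤ 2 * X.pos s t - (X.pos p t + X.pos q t) ∧
        2 * X.pos d t - (X.pos p t + X.pos q t) < 0 ∧
        ∀ ρ, (0 ≤ 2 * X.pos ρ t - (X.pos p t + X.pos q t) → X.pos s t ≤ X.pos ρ t) ∧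
          (2 * X.pos ρ t - (X.pos p t + X.pos q t) < 0 → X.pos ρ t ≤ X.pos d t)) ∧
        ((∀ t ∈ Ioo u v, 0 ≤ X.pos p t + X.pos q t - (X.pos s t + X.pos d t)) ∨
          ∀ t ∈ Ioo u v, ¬ 0 ≤ X.pos p t + X.pos q t - (X.pos s t + X.pos d t))) (σ : Fin n) :
    ∃ ψ, ∀ t ∈ Ioo u v, X.EpsConnected ε t σ ψ ∧
      ∀ ρ, X.EpsConnected ε t σ ρ → X.farDist ψ t ≤ X.farDist ρ t := by
  classical
  obtain ⟨hp, hq, hside⟩ := hS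
  have hmid : (u + v) / 2 ∈ Ioo u v := ⟨by linarith, by linarith⟩
  set t₁ := (u + v) / 2
  have hup : ∀ ρ, 0 ≤ 2 * X.pos ρ t₁ - (X.pos p t₁ + X.pos q t₁) →
      ∀ t ∈ Ioo u v, 0 ≤ 2 * X.pos ρ t - (X.pos p t + X.pos q t) :=
    fun ρ h => (hside ρ).elim id fun H => absurd h (H _ hmid)
  have hdn : ∀ ρ, ¬ 0 ≤ 2 * X.pos ρ t₁ - (X.pos p t₁ + X.pos q t₁) →
      ∀ t ∈ Ioo u v, ¬ 0 ≤ 2 * X.pos ρ t - (X.pos p t + X.pos q t) :=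
    fun ρ h => (hside ρ).elim (fun H => absurd (H _ hmid) h) id
  have hne : (Finset.univ.filter (X.EpsConnected ε t₁ σ)).Nonempty :=
    ⟨σ, by simp [EpsConnected.refl]⟩
  by_cases hA : ∀ ρ, X.EpsConnected ε t₁ σ ρ → 0 ≤ 2 * X.pos ρ t₁ - (X.pos p t₁ + X.pos q t₁)
  · obtain ⟨ψ, hψ, hmin⟩ := Finset.exists_min_image _ (fun ρ => X.pos ρ t₁) hne
    simp only [Finset.mem_filter, Finset.mem_univ, true_and] at hψ hmin
    refine ⟨ψ, fun t ht => ⟨hP.connected hmid ht hψ, fun ρ hρ => ?_⟩⟩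
    have hρ' := hP.connected ht hmid hρ
    have h1 := hup ψ (hA ψ hψ) t ht
    have h2 := hup ρ (hA ρ hρ') t ht
    have h3 := hO.le hmid ht (hmin ρ hρ')
    rw [farDist_eq_max (hp t ht) (hq t ht), farDist_eq_max (hp t ht) (hq t ht)]
    exact max_le (le_max_of_le_right (by linarith)) (le_max_of_le_right (by linarith))
  by_cases hB : ∀ ρ, X.EpsConnected ε t₁ σ ρ → ¬ 0 ≤ 2 * X.pos ρ t₁ - (X.pos p t₁ + X.pos q t₁)
  · obtain ⟨ψ, hψ, hmax⟩ := Finset.exists_max_image _ (fun ρ => X.pos ρ t₁) hne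
    simp only [Finset.mem_filter, Finset.mem_univ, true_and] at hψ hmax
    refine ⟨ψ, fun t ht => ⟨hP.connected hmid ht hψ, fun ρ hρ => ?_⟩⟩
    have hρ' := hP.connected ht hmid hρ
    have h1 := hdn ψ (hB ψ hψ) t ht
    have h2 := hdn ρ (hB ρ hρ') t ht
    have h3 := hO.le hmid ht (hmax ρ hρ')
    rw [farDist_eq_max (hp t ht) (hq t ht), farDist_eq_max (hp t ht) (hq t ht)]
    exact max_le (le_max_of_le_left (by linarith)) (le_max_of_le_left (by linarith))
  push Not at hA hB
  obtain ⟨ρ₁, hc₁, h₁⟩ := hA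
  obtain ⟨ρ₂, hc₂, h₂⟩ := hB
  obtain ⟨s, d, hsd, hsign⟩ := hmix ⟨ρ₂, hup ρ₂ h₂⟩ ⟨ρ₁, hdn ρ₁ (not_le.2 h₁)⟩
  obtain ⟨hs, hd, hnext⟩ := hsd t₁ hmid
  obtain ⟨r, r', hr, hrr', hSr, hSr'⟩ := (hc₂.symm.trans hc₁).exists_step
    (fun ρ => 0 ≤ 2 * X.pos ρ t₁ - (X.pos p t₁ + X.pos q t₁)) h₂ (not_le.2 h₁)
  have hsr := (hnext r).1 hSr
  have hrd := (hnext r').2 (not_le.1 hSr')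
  rw [not_le] at hSr'
  rw [abs_le] at hrr'
  have hcr : X.EpsConnected ε t₁ σ r := hc₂.trans hr
  have hcr' : X.EpsConnected ε t₁ σ r' := hcr.trans (.single (abs_le.2 hrr'))
  have hcs : X.EpsConnected ε t₁ σ s := hcr'.trans
    (.single (abs_le.2 ⟨by linarith [hrr'.2], by linarith [hrr'.2]⟩))
  have hcd : X.EpsConnected ε t₁ σ d := hcr.trans
    (.single (abs_le.2 ⟨by linarith [hrr'.2], by linarith [hrr'.2]⟩))
  rcases hsign with hsign | hsign
  · refine ⟨s, fun t ht => ⟨hP.connected hmid ht hcs, fun ρ _ => ?_⟩⟩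
    obtain ⟨h1, h2, h3⟩ := hsd t ht
    have h4 := hsign t ht
    rw [farDist_eq_max (hp t ht) (hq t ht), farDist_eq_max (hp t ht) (hq t ht)]
    rcases le_or_gt 0 (2 * X.pos ρ t - (X.pos p t + X.pos q t)) with h | h
    · have := (h3 ρ).1 h
      exact max_le (le_max_of_le_right (by linarith)) (le_max_of_le_right (by linarith))
    · have := (h3 ρ).2 h
      exact max_le (le_max_of_le_left (by linarith)) (le_max_of_le_left (by linarith))
  · refine ⟨d, fun t ht => ⟨hP.connected hmid ht hcd, fun ρ _ => ?_⟩⟩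
    obtain ⟨h1, h2, h3⟩ := hsd t ht
    have h4 := hsign t ht
    rw [farDist_eq_max (hp t ht) (hq t ht), farDist_eq_max (hp t ht) (hq t ht)]
    rcases le_or_gt 0 (2 * X.pos ρ t - (X.pos p t + X.pos q t)) with h | h
    · have := (h3 ρ).1 h
      exact max_le (le_max_of_le_right (by linarith)) (le_max_of_le_right (by linarith))
    · have := (h3 ρ).2 h
      exact max_le (le_max_of_le_left (by linarith)) (le_max_of_le_left (by linarith))

theorem FixedSides.mono {p q : Fin n} (h : X.FixedSides p q a b) (hu : a ≤ u) (hv : v ≤ b) :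
    X.FixedSides p q u v :=
  have hsub := Ioo_subset_Ioo hu hv
  ⟨fun t ht => h.1 t (hsub ht), fun t ht => h.2.1 t (hsub ht),
    fun σ => (h.2.2 σ).imp (fun H t ht => H t (hsub ht)) fun H t ht => H t (hsub ht)⟩

theorem FixedOrder.mono (h : X.FixedOrder a b) (hu : a ≤ u) (hv : v ≤ b) : X.FixedOrder u v :=
  have hsub := Ioo_subset_Ioo hu hv
  fun σ ψ => (h σ ψ).imp (fun H t ht => H t (hsub ht)) fun H t ht => H t (hsub ht)

theorem FixedProximity.mono (h : X.FixedProximity ε a b) (hu : a ≤ u) (hv : v ≤ b) :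
    X.FixedProximity ε u v :=
  have hsub := Ioo_subset_Ioo hu hv
  fun σ ψ => (h σ ψ).imp (fun H t ht => H t (hsub ht)) fun H t ht => H t (hsub ht)

theorem cutInto_steady_of_fixed (h : X.AffineOn a b) {p q : Fin n} (hab : a < b)
    (hS : X.FixedSides p q a b) (hO : X.FixedOrder a b) (hP : X.FixedProximity ε a b) :
    CutInto (X.Steady ε) a b 2 := by
  classical
  have hmid : (a + b) / 2 ∈ Ioo a b := ⟨by linarith, by linarith⟩
  set t₁ := (a + b) / 2
  set U := Finset.univ.filter fun σ => 0 ≤ 2 * X.pos σ t₁ - (X.pos p t₁ + X.pos q t₁) with hU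
  set D := Finset.univ.filter fun σ => ¬ 0 ≤ 2 * X.pos σ t₁ - (X.pos p t₁ + X.pos q t₁) with hD
  by_cases hne : U.Nonempty ∧ D.Nonempty
  · obtain ⟨s, hs, hsmin⟩ := Finset.exists_min_image U (fun ρ => X.pos ρ t₁) hne.1
    obtain ⟨d, hd, hdmax⟩ := Finset.exists_max_image D (fun ρ => X.pos ρ t₁) hne.2
    simp only [hU, hD, Finset.mem_filter, Finset.mem_univ, true_and] at hs hd hsmin hdmax
    obtain ⟨α, β, hαβ⟩ := h
    refine (cutInto_sign (g := fun t => X.pos p t + X.pos q t - (X.pos s t + X.pos d t))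
      ⟨α p + α q - (α s + α d), β p + β q - (β s + β d), fun t ht => by
        rw [hαβ _ t ht, hαβ _ t ht, hαβ _ t ht, hαβ _ t ht]; ring⟩).mono le_rfl ?_
    intro u v hu huv hv hsign
    refine ⟨hP.mono hu hv, exists_best_of_fixed (hS.mono hu hv) (hO.mono hu hv) (hP.mono hu hv)
      huv fun _ _ => ⟨s, d, fun t ht => ?_, hsign⟩⟩
    have ht' := Ioo_subset_Ioo hu hv ht
    have hside := hS.2.2
    refine ⟨(hside s).elim (fun H => H t ht') fun H => absurd hs (H _ hmid),
      (hside d).elim (fun H => absurd (H _ hmid) hd) fun H => not_le.1 (H t ht'), fun ρ => ⟨?_, ?_⟩⟩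
    · intro h
      refine hO.le hmid ht' (hsmin ρ ?_)
      exact (hside ρ).elim (fun H => H _ hmid) fun H => absurd h (H t ht')
    · intro h
      refine hO.le hmid ht' (hdmax ρ ?_)
      exact (hside ρ).elim (fun H => absurd (H t ht') (not_le.2 h)) fun H => H _ hmid
  · refine (CutInto.of_forall fun u v hu huv hv => ?_).mono (Nat.zero_le 2) fun _ _ _ _ _ h => h
    refine ⟨hP.mono hu hv, exists_best_of_fixed (hS.mono hu hv) (hO.mono hu hv) (hP.mono hu hv)
      huv fun ⟨σ, hσ⟩ ⟨ρ, hρ⟩ => absurd ?_ hne⟩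
    have huv' : (u + v) / 2 ∈ Ioo u v := ⟨by linarith, by linarith⟩
    have huv'' := Ioo_subset_Ioo hu hv huv'
    refine ⟨⟨σ, ?_⟩, ⟨ρ, ?_⟩⟩
    · simp only [hU, Finset.mem_filter, Finset.mem_univ, true_and]
      exact (hS.2.2 σ).elim (fun H => H _ hmid) fun H => absurd (hσ _ huv') (H _ huv'')
    · simp only [hD, Finset.mem_filter, Finset.mem_univ, true_and]
      exact (hS.2.2 ρ).elim (fun H => absurd (H _ huv'') (hρ _ huv')) fun H => H _ hmid

theorem cutInto_steady_of_affineOn (hn : 1 ≤ n) (h : X.AffineOn a b) :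
    CutInto (X.Steady ε) a b (56 * n ^ 2) := by
  have : Nonempty (Fin n) := ⟨⟨0, hn⟩⟩
  refine (((cutInto_fixedSides h).and ((cutInto_order h).and (cutInto_proximity (ε := ε) h))).refine
    (Q := X.Steady ε) (l := 2) ?_).mono ?_ fun _ _ _ _ _ h => h
  · rintro u v hu huv hv ⟨⟨p, q, hS⟩, hO, hP⟩
    exact cutInto_steady_of_fixed (h.mono hu hv) huv hS hO hP
  · nlinarith

theorem exists_mem_piece (X : MovingEntities n τ) {u : ℝ} (hu : X.start ≤ u) (hu' : u < X.finish) :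
    ∃ i : Fin τ, X.time i.castSucc ≤ u ∧ u < X.time i.succ := by
  classical
  obtain ⟨j, hj, hmax⟩ := Finset.exists_max_image (Finset.univ.filter fun i => X.time i ≤ u) id
    ⟨0, by simpa [start] using hu⟩
  simp only [Finset.mem_filter, Finset.mem_univ, true_and, id] at hj hmax
  have hjl : j ≠ Fin.last τ := by
    rintro rfl
    exact absurd hj (not_le.2 hu')
  refine ⟨j.castPred hjl, by simpa using hj, ?_⟩
  by_contra! hle
  have := hmax _ hle
  rw [Fin.le_def] at this
  simp at this

theorem exists_piece (X : MovingEntities n τ) {u v : ℝ} (hu : X.start ≤ u) (huv : u < v)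
    (hv : v ≤ X.finish) (h : ∀ i, X.time i ∉ Ioo u v) :
    ∃ i : Fin τ, X.time i.castSucc ≤ u ∧ v ≤ X.time i.succ := by
  obtain ⟨i, hi, hi'⟩ := X.exists_mem_piece hu (huv.trans_le hv)
  exact ⟨i, hi, not_lt.1 fun hlt => h _ ⟨hi', hlt⟩⟩

/-- `O(τ n²)` points cut the whole time interval into steady ones. -/
theorem cutInto_steady (hn : 1 ≤ n) (hτ : 1 ≤ τ) :
    CutInto (X.Steady ε) X.start X.finish (170 * (τ * n ^ 2)) := by
  classical
  have h1 : CutInto (X.AffineOn · ·) X.start X.finish (τ + 1) := by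
    refine ⟨Finset.univ.image X.time, Finset.card_image_le.trans (by simp), ?_⟩
    intro u v hu huv hv hg
    obtain ⟨i, hi, hi'⟩ := X.exists_piece hu huv hv fun i => hg _ (by simp)
    choose α β h using fun σ => X.linear_on_pieces σ i
    exact ⟨α, β, fun σ t ht => h σ t ⟨hi.trans ht.1, ht.2.trans hi'⟩⟩
  refine (h1.refine fun u v _ _ _ h => cutInto_steady_of_affineOn hn h).mono ?_
    fun _ _ _ _ _ h => h
  have : 1 ≤ n ^ 2 := Nat.one_le_pow _ _ hn
  nlinarith [Nat.mul_le_mul hτ this]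

end MovingEntities

namespace MovingEntities

variable {n τ : ℕ} {X : MovingEntities n τ} {ε u v : ℝ} {c c' : ℝ → Fin n}

/-! ### Trajectoids -/

theorem start_lt_finish (X : MovingEntities n τ) (hτ : 1 ≤ τ) : X.start < X.finish :=
  X.time_strictMono (by rw [Fin.lt_def]; simp; omega)

theorem exists_mem_Icc_piece (X : MovingEntities n τ) (hτ : 1 ≤ τ) {t : ℝ}
    (ht : t ∈ Icc X.start X.finish) :
    ∃ i : Fin τ, t ∈ Icc (X.time i.castSucc) (X.time i.succ) := by
  rcases ht.2.lt_or_eq with hlt | heq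
  · obtain ⟨i, hi, hi'⟩ := X.exists_mem_piece ht.1 hlt
    exact ⟨i, hi, hi'.le⟩
  · obtain ⟨m, rfl⟩ : ∃ m, τ = m + 1 := ⟨τ - 1, by omega⟩
    refine ⟨Fin.last m, ?_, ?_⟩
    · rw [heq]
      exact X.time_strictMono.monotone (Fin.le_last _)
    · rw [heq, Fin.succ_last]
      exact le_rfl

theorem continuousOn_pos (X : MovingEntities n τ) (hτ : 1 ≤ τ) (σ : Fin n) :
    ContinuousOn (X.pos σ) (Icc X.start X.finish) := by
  have h : ContinuousOn (X.pos σ)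
      (⋃ i : Fin τ, Icc (X.time i.castSucc) (X.time i.succ)) := by
    refine (locallyFinite_of_finite _).continuousOn_iUnion (fun i => isClosed_Icc) fun i => ?_
    obtain ⟨α, β, h⟩ := X.linear_on_pieces σ i
    exact ContinuousOn.congr (f := fun t => α + β * t) (by fun_prop) h
  exact h.mono fun t ht => mem_iUnion.2 (X.exists_mem_Icc_piece hτ ht)

theorem continuousOn_farDist (X : MovingEntities n τ) (hτ : 1 ≤ τ) (σ : Fin n) :
    ContinuousOn (X.farDist σ) (Icc X.start X.finish) := by
  have : Nonempty (Fin n) := ⟨σ⟩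
  have h : X.farDist σ =
      fun t => Finset.univ.sup' Finset.univ_nonempty fun ψ => |X.pos σ t - X.pos ψ t| := by
    funext t
    rw [Finset.sup'_univ_eq_ciSup]
    rfl
  rw [h]
  exact ContinuousOn.finset_sup'_apply _ fun ψ _ =>
    ((X.continuousOn_pos hτ σ).sub (X.continuousOn_pos hτ ψ)).abs

theorem IsTrajectoid.exists_right (h : X.IsTrajectoid ε c) {t : ℝ} (ht : X.start ≤ t)
    (ht' : t < X.finish) :
    ∃ ψ, (∀ᶠ s in 𝓝[>] t, c s = ψ) ∧ X.EpsConnected ε t (c t) ψ := by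
  rcases ht.eq_or_lt with rfl | hlt
  · exact ⟨_, h.1, .refl _⟩
  · obtain ⟨σ, ψ, -, hψ, hct, hconn⟩ := h.2.2 t ⟨hlt, ht'⟩
    refine ⟨ψ, hψ, ?_⟩
    rcases hct with hct | hct
    · rwa [hct]
    · rw [hct]; exact .refl _

theorem IsTrajectoid.exists_left (h : X.IsTrajectoid ε c) {t : ℝ} (ht : X.start < t)
    (ht' : t ≤ X.finish) :
    ∃ ψ, (∀ᶠ s in 𝓝[<] t, c s = ψ) ∧ X.EpsConnected ε t (c t) ψ := by
  rcases ht'.eq_or_lt with rfl | hlt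
  · exact ⟨_, h.2.1, .refl _⟩
  · obtain ⟨σ, ψ, hσ, -, hct, hconn⟩ := h.2.2 t ⟨ht, hlt⟩
    refine ⟨σ, hσ, ?_⟩
    rcases hct with hct | hct
    · rw [hct]; exact .refl _
    · rw [hct]; exact hconn.symm

theorem isTrajectoid_const (σ : Fin n) : X.IsTrajectoid ε fun _ => σ :=
  ⟨.of_forall fun _ => rfl, .of_forall fun _ => rfl, fun _ _ =>
    ⟨σ, σ, .of_forall fun _ => rfl, .of_forall fun _ => rfl, Or.inl rfl, .refl _⟩⟩

/-- Near each time in `[t_0, t_τ]`, a trajectoid jumps at most at that time itself; by compactness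
there are finitely many jumps. -/
theorem IsTrajectoid.finite_jumpTimes (h : X.IsTrajectoid ε c) : (X.jumpTimes c).Finite := by
  have hmain : (X.jumpTimes c ∩ Icc X.start X.finish).Finite := by
    refine isCompact_Icc.induction_on (p := fun S => (X.jumpTimes c ∩ S).Finite) (by simp)
      (fun S T hST hT => hT.subset (inter_subset_inter_right _ hST))
      (fun S T hS hT => by rw [inter_union_distrib_left]; exact hS.union hT) fun t ht => ?_
    have hr : ∀ᶠ s in 𝓝[>] t, s ∉ X.jumpTimes c := by
      rcases ht.2.lt_or_eq with hlt | rfl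
      · obtain ⟨ψ, hψ, -⟩ := h.exists_right ht.1 hlt
        have h2 : ∀ᶠ s in 𝓝[>] t, ∀ᶠ r in 𝓝 s, c r = ψ := by
          obtain ⟨w, hw, hw'⟩ := mem_nhdsGT_iff_exists_Ioo_subset.1 hψ
          exact mem_of_superset (Ioo_mem_nhdsGT hw)
            fun s hs => mem_of_superset (Ioo_mem_nhds hs.1 hs.2) hw'
        filter_upwards [h2] with s hs hj
        exact hj.2 (by rw [hs.self_of_nhds]; exact hs)
      · filter_upwards [self_mem_nhdsWithin] with s hs hj
        exact absurd hj.1.2 (not_lt.2 (le_of_lt hs))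
    have hl : ∀ᶠ s in 𝓝[<] t, s ∉ X.jumpTimes c := by
      rcases ht.1.lt_or_eq with hlt | rfl
      · obtain ⟨ψ, hψ, -⟩ := h.exists_left hlt ht.2
        have h2 : ∀ᶠ s in 𝓝[<] t, ∀ᶠ r in 𝓝 s, c r = ψ := by
          obtain ⟨w, hw, hw'⟩ := mem_nhdsLT_iff_exists_Ioo_subset.1 hψ
          exact mem_of_superset (Ioo_mem_nhdsLT hw)
            fun s hs => mem_of_superset (Ioo_mem_nhds hs.1 hs.2) hw'
        filter_upwards [h2] with s hs hj
        exact hj.2 (by rw [hs.self_of_nhds]; exact hs)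
      · filter_upwards [self_mem_nhdsWithin] with s hs hj
        exact absurd hj.1.1 (not_lt.2 (le_of_lt hs))
    have hne : {s | s ∉ X.jumpTimes c} ∈ 𝓝[≠] t := by
      rw [← Iio_union_Ioi, nhdsWithin_union]
      exact ⟨hl, hr⟩
    refine ⟨insert t {s | s ∉ X.jumpTimes c}, mem_nhdsWithin_of_mem_nhds ?_, ?_⟩
    · rw [← insert_mem_nhds_iff] at hne
      exact hne
    · refine (finite_singleton t).subset fun s hs => ?_
      rcases hs.2 with h2 | h2
      · exact h2
      · exact absurd hs.1 h2
  exact hmain.subset fun s hs => ⟨hs, hs.1.1.le, hs.1.2.le⟩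

theorem IsTrajectoid.intervalIntegrable (h : X.IsTrajectoid ε c) (hτ : 1 ≤ τ) :
    IntervalIntegrable (fun t => X.farDist (c t) t) MeasureTheory.volume X.start X.finish := by
  classical
  rw [intervalIntegrable_iff_integrableOn_Ioo_of_le (X.start_lt_finish hτ).le]
  have hmeas : ∀ σ, MeasurableSet (Ioo X.start X.finish ∩ {t | c t = σ}) := by
    intro σ
    have hopen : IsOpen {t | t ∈ Ioo X.start X.finish ∧ ∀ᶠ s in 𝓝 t, c s = σ} := by
      rw [isOpen_iff_mem_nhds]
      rintro t ⟨ht, hc⟩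
      filter_upwards [isOpen_Ioo.mem_nhds ht, eventually_eventually_nhds.2 hc] with s hs hs'
      exact ⟨hs, hs'⟩
    have heq : Ioo X.start X.finish ∩ {t | c t = σ} =
        {t | t ∈ Ioo X.start X.finish ∧ ∀ᶠ s in 𝓝 t, c s = σ} ∪
          (X.jumpTimes c ∩ {t | c t = σ}) := by
      ext t
      constructor
      · rintro ⟨ht, hc⟩
        by_cases hj : ∀ᶠ s in 𝓝 t, c s = c t
        · left
          refine ⟨ht, ?_⟩
          rw [← show c t = σ from hc]
          exact hj
        · exact Or.inr ⟨⟨ht, hj⟩, hc⟩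
      · rintro (⟨ht, hc⟩ | ⟨hj, hc⟩)
        · exact ⟨ht, hc.self_of_nhds⟩
        · exact ⟨hj.1, hc⟩
    rw [heq]
    exact hopen.measurableSet.union (h.finite_jumpTimes.subset inter_subset_left).measurableSet
  have hsum : MeasureTheory.IntegrableOn (fun t => ∑ σ,
      (Ioo X.start X.finish ∩ {t | c t = σ}).indicator (X.farDist σ) t)
      (Ioo X.start X.finish) MeasureTheory.volume := by
    refine MeasureTheory.integrable_finsetSum _ fun σ _ => ?_
    refine MeasureTheory.Integrable.indicator ?_ (hmeas σ)
    exact ((X.continuousOn_farDist hτ σ).integrableOn_compact isCompact_Icc).mono_set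
      Ioo_subset_Icc_self
  refine hsum.congr_fun (fun t ht => ?_) measurableSet_Ioo
  change ∑ σ, _ = X.farDist (c t) t
  rw [Finset.sum_eq_single (c t)]
  · exact indicator_of_mem (show t ∈ _ ∩ {s | c s = c t} from ⟨ht, rfl⟩) _
  · intro σ _ hσ
    exact indicator_of_notMem (fun hm => hσ hm.2.symm) _
  · simp

theorem ae_restrict_of_forall_notMem {G : Finset ℝ} {p : ℝ → Prop} {a b : ℝ}
    (h : ∀ t ∈ Ioo a b, t ∉ G → p t) :
    ∀ᵐ t ∂MeasureTheory.volume.restrict (Icc a b), p t := by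
  rw [← MeasureTheory.restrict_Ioo_eq_restrict_Icc, MeasureTheory.ae_restrict_iff' measurableSet_Ioo]
  have hG : ∀ᵐ t ∂(MeasureTheory.volume : MeasureTheory.Measure ℝ), t ∉ (G : Set ℝ) :=
    MeasureTheory.measure_eq_zero_iff_ae_notMem.1 (G.finite_toSet.measure_zero _)
  filter_upwards [hG] with t ht hm
  exact h t hm (by simpa using ht)

theorem cost_le_cost (hτ : 1 ≤ τ) (h : X.IsTrajectoid ε c) (h' : X.IsTrajectoid ε c')
    {G : Finset ℝ} (hle : ∀ t ∈ Ioo X.start X.finish, t ∉ G →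
      X.farDist (c' t) t ≤ X.farDist (c t) t) : X.cost c' ≤ X.cost c :=
  intervalIntegral.integral_mono_ae_restrict (X.start_lt_finish hτ).le
    (h'.intervalIntegrable hτ) (h.intervalIntegrable hτ) (ae_restrict_of_forall_notMem hle)

/-- If `c'` is pointwise at least as good as `c`, but not cheaper, then no interval is one on which
`c'` is strictly better throughout. -/
theorem exists_farDist_eq (hτ : 1 ≤ τ) (h : X.IsTrajectoid ε c) (h' : X.IsTrajectoid ε c')
    {G : Finset ℝ} (hle : ∀ t ∈ Ioo X.start X.finish, t ∉ G →
      X.farDist (c' t) t ≤ X.farDist (c t) t) (hcost : X.cost c ≤ X.cost c')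
    (hu : X.start ≤ u) (huv : u < v) (hv : v ≤ X.finish) :
    ∃ t ∈ Ioo u v, t ∉ G ∧ X.farDist (c' t) t = X.farDist (c t) t := by
  have hlt := (X.start_lt_finish hτ).le
  have heq : X.cost c' = X.cost c := le_antisymm (cost_le_cost hτ h h' hle) hcost
  unfold cost at heq
  rw [intervalIntegral.integral_of_le hlt, intervalIntegral.integral_of_le hlt] at heq
  have hae := ae_restrict_of_forall_notMem hle
  rw [← MeasureTheory.restrict_Ioc_eq_restrict_Icc] at hae
  have h1 := (MeasureTheory.integral_eq_iff_of_ae_le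
    ((intervalIntegrable_iff_integrableOn_Ioc_of_le hlt).1 (h'.intervalIntegrable hτ))
    ((intervalIntegrable_iff_integrableOn_Ioc_of_le hlt).1 (h.intervalIntegrable hτ)) hae).1 heq
  have h2 := MeasureTheory.ae_restrict_of_ae_restrict_of_subset
    (show Ioo u v ⊆ Ioc X.start X.finish from
      fun t ht => ⟨hu.trans_lt ht.1, ht.2.le.trans hv⟩) h1
  by_contra! hne
  have h3 : ∀ᵐ t ∂MeasureTheory.volume.restrict (Ioo u v), False := by
    have hG : ∀ᵐ t ∂MeasureTheory.volume.restrict (Icc u v), t ∉ G :=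
      ae_restrict_of_forall_notMem fun t _ htG => htG
    rw [← MeasureTheory.restrict_Ioo_eq_restrict_Icc] at hG
    filter_upwards [h2, hG, MeasureTheory.ae_restrict_mem measurableSet_Ioo] with t ht htG hm
    exact hne t hm htG ht
  rw [eventually_false_iff_eq_bot, MeasureTheory.ae_eq_bot, MeasureTheory.Measure.restrict_eq_zero,
    Real.volume_Ioo, ENNReal.ofReal_eq_zero] at h3
  linarith

/-- A trajectoid all of whose constant pieces in `(u, v)` have value `ψ` is `ψ` there. -/
theorem IsTrajectoid.eq_of_forall_subinterval (h : X.IsTrajectoid ε c) (hu : X.start ≤ u)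
    (hv : v ≤ X.finish) {ψ : Fin n}
    (H : ∀ ρ u' v', u ≤ u' → u' < v' → v' ≤ v → (∀ t ∈ Ioo u' v', c t = ρ) → ρ = ψ) :
    ∀ t ∈ Ioo u v, c t = ψ := by
  intro t ht
  obtain ⟨σ, ρ, hσ, hρ, hct, -⟩ := h.2.2 t ⟨hu.trans_lt ht.1, ht.2.trans_le hv⟩
  have h1 : ρ = ψ := by
    obtain ⟨w, hw, hw'⟩ := mem_nhdsGT_iff_exists_Ioo_subset.1 hρ
    refine H ρ t (min w v) ht.1.le (lt_min hw ht.2) (min_le_right _ _) fun s hs => ?_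
    exact hw' ⟨hs.1, hs.2.trans_le (min_le_left _ _)⟩
  have h2 : σ = ψ := by
    obtain ⟨w, hw, hw'⟩ := mem_nhdsLT_iff_exists_Ioo_subset.1 hσ
    refine H σ (max w u) t (le_max_right _ _) (max_lt hw ht.1) ht.2.le fun s hs => ?_
    exact hw' ⟨(le_max_left _ _).trans_lt hs.1, hs.2⟩
  rcases hct with hct | hct
  · rw [hct, h2]
  · rw [hct, h1]

/-- While the proximity graph does not change, a trajectoid stays in one component. -/
theorem IsTrajectoid.connected_of_fixedProximity (h : X.IsTrajectoid ε c) (hu : X.start ≤ u)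
    (hv : v ≤ X.finish) (hP : X.FixedProximity ε u v) {s t : ℝ} (hs : s ∈ Ioo u v)
    (ht : t ∈ Ioo u v) : X.EpsConnected ε t (c s) (c t) := by
  refine isPreconnected_Ioo.induction₂ (s := Ioo u v) (fun s t => ∀ r ∈ Ioo u v,
    X.EpsConnected ε r (c s) (c t)) ?_ ?_ ?_ hs ht t ht
  · intro x hx
    have hx' : x ∈ Ioo X.start X.finish := ⟨hu.trans_lt hx.1, hx.2.trans_le hv⟩
    obtain ⟨ψ, hψ, hcψ⟩ := h.exists_right hx'.1.le hx'.2
    obtain ⟨σ, hσ, hcσ⟩ := h.exists_left hx'.1 hx'.2.le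
    refine mem_nhdsWithin_of_mem_nhds ?_
    have hne : {y | ∀ r ∈ Ioo u v, X.EpsConnected ε r (c x) (c y)} ∈ 𝓝[≠] x := by
      rw [← Iio_union_Ioi, nhdsWithin_union]
      constructor
      · filter_upwards [hσ] with y hy r hr
        rw [hy]
        exact hP.connected hx hr hcσ
      · filter_upwards [hψ] with y hy r hr
        rw [hy]
        exact hP.connected hx hr hcψ
    rw [← insert_mem_nhds_iff, insert_eq_of_mem] at hne
    · exact hne
    · exact fun r _ => .refl _
  · intro x y z hx hy hz h1 h2 r hr
    exact (h1 r hr).trans (h2 r hr)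
  · intro x y hx hy h1 r hr
    exact (h1 r hr).symm

/-- Proximity is a closed condition, so what is connected in the open interval is connected at its
end points. -/
theorem FixedProximity.connected_Icc (hτ : 1 ≤ τ) (hu : X.start ≤ u)
    (hv : v ≤ X.finish) (hP : X.FixedProximity ε u v) {s t : ℝ} (ht : t ∈ Ioo u v)
    (hs : s ∈ Icc u v) {σ ψ : Fin n} (h : X.EpsConnected ε t σ ψ) : X.EpsConnected ε s σ ψ := by
  refine Relation.ReflTransGen.mono (fun ρ ρ' hr => ?_) _ _ h
  have h1 : ∀ t ∈ Ioo u v, |X.pos ρ t - X.pos ρ' t| ≤ ε :=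
    (hP ρ ρ').elim id fun H => absurd hr (H t ht)
  have hcont : ContinuousOn (fun t => |X.pos ρ t - X.pos ρ' t|) (Icc u v) :=
    (((X.continuousOn_pos hτ ρ).sub (X.continuousOn_pos hτ ρ')).abs).mono (Icc_subset_Icc hu hv)
  have hcl : closure (Ioo u v) = Icc u v := closure_Ioo (ht.1.trans ht.2).ne
  rw [← hcl] at hcont hs
  exact ((hcont s hs).mono subset_closure).closure_le hs continuousWithinAt_const h1

/-- Rerouting a trajectoid, during an interval with unchanging proximity graph, to another entity of
the component in which it stays. -/
theorem IsTrajectoid.reroute (h : X.IsTrajectoid ε c) (hτ : 1 ≤ τ) (hu : X.start ≤ u)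
    (huv : u < v) (hv : v ≤ X.finish) (hP : X.FixedProximity ε u v) {ψ : Fin n} {t₁ : ℝ}
    (ht₁ : t₁ ∈ Ioo u v) (hψ : X.EpsConnected ε t₁ (c t₁) ψ) :
    X.IsTrajectoid ε ((Icc u v).piecewise (fun _ => ψ) c) := by
  classical
  set d := (Icc u v).piecewise (fun _ => ψ) c with hd
  have hin : ∀ t ∈ Icc u v, d t = ψ := fun t ht => piecewise_eq_of_mem _ _ _ ht
  have hlt : ∀ t < u, d t = c t := fun t ht => piecewise_eq_of_notMem _ _ _ fun hm =>
    absurd hm.1 (not_le.2 ht)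
  have hgt : ∀ t, v < t → d t = c t := fun t ht => piecewise_eq_of_notMem _ _ _ fun hm =>
    absurd hm.2 (not_le.2 ht)
  have hcψ : ∀ s ∈ Ioo u v, ∀ t ∈ Icc u v, X.EpsConnected ε t (c s) ψ := fun s hs t ht =>
    hP.connected_Icc hτ hu hv ht₁ ht ((h.connected_of_fixedProximity hu hv hP hs ht₁).trans hψ)
  have hr : ∀ t, u ≤ t → t < v → ∀ᶠ s in 𝓝[>] t, d s = ψ := fun t ht ht' => by
    filter_upwards [Ioo_mem_nhdsGT ht'] with s hs
    exact hin s ⟨ht.trans hs.1.le, hs.2.le⟩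
  have hl : ∀ t, u < t → t ≤ v → ∀ᶠ s in 𝓝[<] t, d s = ψ := fun t ht ht' => by
    filter_upwards [Ioo_mem_nhdsLT ht] with s hs
    exact hin s ⟨hs.1.le, hs.2.le.trans ht'⟩
  have hr1 : ∀ t < u, ∀ ρ, (∀ᶠ s in 𝓝[>] t, c s = ρ) → ∀ᶠ s in 𝓝[>] t, d s = ρ :=
    fun t ht ρ hρ => by
      filter_upwards [hρ, Ioo_mem_nhdsGT ht] with s hs hs'
      rw [hlt s hs'.2, hs]
  have hl1 : ∀ t ≤ u, ∀ ρ, (∀ᶠ s in 𝓝[<] t, c s = ρ) → ∀ᶠ s in 𝓝[<] t, d s = ρ :=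
    fun t ht ρ hρ => by
      filter_upwards [hρ, self_mem_nhdsWithin] with s hs hs'
      rw [hlt s (lt_of_lt_of_le hs' ht), hs]
  have hr2 : ∀ t, v ≤ t → ∀ ρ, (∀ᶠ s in 𝓝[>] t, c s = ρ) → ∀ᶠ s in 𝓝[>] t, d s = ρ :=
    fun t ht ρ hρ => by
      filter_upwards [hρ, self_mem_nhdsWithin] with s hs hs'
      rw [hgt s (lt_of_le_of_lt ht hs'), hs]
  have hl2 : ∀ t, v < t → ∀ ρ, (∀ᶠ s in 𝓝[<] t, c s = ρ) → ∀ᶠ s in 𝓝[<] t, d s = ρ :=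
    fun t ht ρ hρ => by
      filter_upwards [hρ, Ioo_mem_nhdsLT ht] with s hs hs'
      rw [hgt s hs'.1, hs]
  refine ⟨?_, ?_, fun t ht => ?_⟩
  · rcases hu.eq_or_lt with heq | hlt'
    · rw [hin _ ⟨heq.ge, heq.le.trans huv.le⟩]
      exact hr _ heq.ge (heq.trans_lt huv)
    · rw [hlt _ hlt']
      exact hr1 _ hlt' _ h.1
  · rcases hv.eq_or_lt with heq | hlt'
    · rw [hin _ ⟨huv.le.trans heq.le, heq.ge⟩]
      exact hl _ (huv.trans_eq heq) heq.ge
    · rw [hgt _ hlt']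
      exact hl2 _ hlt' _ h.2.1
  obtain ⟨σ, ρ, hσ, hρ, hct, hconn⟩ := h.2.2 t ht
  rcases lt_trichotomy t u with h1 | rfl | h1
  · exact ⟨σ, ρ, hl1 t h1.le _ hσ, hr1 t h1 _ hρ, by rwa [hlt t h1], hconn⟩
  · refine ⟨σ, ψ, hl1 t le_rfl _ hσ, hr t le_rfl huv, Or.inr (hin t ⟨le_rfl, huv.le⟩), ?_⟩
    obtain ⟨s, hs, hs'⟩ := (hρ.and (Ioo_mem_nhdsGT huv)).exists
    have := hcψ s hs' t ⟨le_rfl, huv.le⟩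
    rw [hs] at this
    exact hconn.trans this
  rcases lt_trichotomy t v with h2 | rfl | h2
  · exact ⟨ψ, ψ, hl t h1 h2.le, hr t h1.le h2, Or.inl (hin t ⟨h1.le, h2.le⟩), .refl _⟩
  · refine ⟨ψ, ρ, hl t h1 le_rfl, hr2 t le_rfl _ hρ, Or.inl (hin t ⟨h1.le, le_rfl⟩), ?_⟩
    obtain ⟨s, hs, hs'⟩ := (hσ.and (Ioo_mem_nhdsLT huv)).exists
    have := hcψ s hs' t ⟨huv.le, le_rfl⟩
    rw [hs] at this
    exact this.symm.trans hconn
  · exact ⟨σ, ρ, hl2 t h2 _ hσ, hr2 t h2.le _ hρ, by rwa [hgt t h2], hconn⟩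

end MovingEntities

namespace MovingEntities

variable {n τ : ℕ} {X : MovingEntities n τ} {ε u v : ℝ} {c c' : ℝ → Fin n}

/-! ### Following the best entity of each component -/

/-- `G` is a finite set of times in `[t_0, t_τ]`, including the end points, such that the motion is
steady during each interval avoiding `G`. -/
structure IsSteadyCut (X : MovingEntities n τ) (ε : ℝ) (G : Finset ℝ) : Prop where
  start_mem : X.start ∈ G
  finish_mem : X.finish ∈ G
  subset : ∀ g ∈ G, g ∈ Icc X.start X.finish
  steady : ∀ u v, X.start ≤ u → u < v → v ≤ X.finish → (∀ g ∈ G, g ∉ Ioo u v) → X.Steady ε u v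

/-- `u` and `v` are consecutive elements of `G`. -/
def IsGap (G : Finset ℝ) (u v : ℝ) : Prop :=
  u ∈ G ∧ v ∈ G ∧ u < v ∧ ∀ g ∈ G, g ∉ Ioo u v

theorem exists_isSteadyCut (X : MovingEntities n τ) (ε : ℝ) (hn : 1 ≤ n) (hτ : 1 ≤ τ) :
    ∃ G : Finset ℝ, X.IsSteadyCut ε G ∧ G.card ≤ 172 * (τ * n ^ 2) := by
  classical
  obtain ⟨G, hG, hst⟩ := cutInto_steady (X := X) (ε := ε) hn hτ
  have hlt := (X.start_lt_finish hτ).le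
  refine ⟨insert X.start (insert X.finish (G.filter (· ∈ Icc X.start X.finish))),
    ⟨by simp, by simp, ?_, fun u v hu huv hv hg => hst u v hu huv hv fun g h hguv => ?_⟩, ?_⟩
  · intro g hg
    simp only [Finset.mem_insert, Finset.mem_filter] at hg
    rcases hg with rfl | rfl | hg
    exacts [⟨le_rfl, hlt⟩, ⟨hlt, le_rfl⟩, hg.2]
  · refine hg g ?_ hguv
    simp only [Finset.mem_insert, Finset.mem_filter]
    exact Or.inr (Or.inr ⟨h, hu.trans hguv.1.le, hguv.2.le.trans hv⟩)
  · have h1 := Finset.card_insert_le X.start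
      (insert X.finish (G.filter (· ∈ Icc X.start X.finish)))
    have h2 := Finset.card_insert_le X.finish (G.filter (· ∈ Icc X.start X.finish))
    have h3 := Finset.card_filter_le G (· ∈ Icc X.start X.finish)
    have h4 : 1 ≤ τ * n ^ 2 := Nat.mul_pos hτ (Nat.pow_pos hn)
    omega

namespace IsSteadyCut

variable {G : Finset ℝ}

theorem exists_isGap (hG : X.IsSteadyCut ε G) {t : ℝ} (ht : t ∈ Ioo X.start X.finish)
    (htG : t ∉ G) : ∃ u v, IsGap G u v ∧ t ∈ Ioo u v := by
  classical
  obtain ⟨u, hu, hmax⟩ := Finset.exists_max_image (G.filter (· < t)) id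
    ⟨X.start, by simpa using ⟨hG.start_mem, ht.1⟩⟩
  obtain ⟨v, hv, hmin⟩ := Finset.exists_min_image (G.filter (t < ·)) id
    ⟨X.finish, by simpa using ⟨hG.finish_mem, ht.2⟩⟩
  simp only [Finset.mem_filter, id] at hu hv hmax hmin
  refine ⟨u, v, ⟨hu.1, hv.1, hu.2.trans hv.2, fun g hg hguv => ?_⟩, hu.2, hv.2⟩
  rcases lt_trichotomy g t with h | rfl | h
  · exact absurd (hmax g ⟨hg, h⟩) (not_le.2 hguv.1)
  · exact htG hg
  · exact absurd (hmin g ⟨hg, h⟩) (not_le.2 hguv.2)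

theorem start_le (hG : X.IsSteadyCut ε G) (h : IsGap G u v) : X.start ≤ u := (hG.subset u h.1).1

theorem le_finish (hG : X.IsSteadyCut ε G) (h : IsGap G u v) : v ≤ X.finish :=
  (hG.subset v h.2.1).2

theorem steady_of_isGap (hG : X.IsSteadyCut ε G) (h : IsGap G u v) : X.Steady ε u v :=
  hG.steady u v (hG.start_le h) h.2.2.1 (hG.le_finish h) h.2.2.2

end IsSteadyCut

theorem IsGap.eq_of_mem {G : Finset ℝ} {u' v' t : ℝ} (h : IsGap G u v) (h' : IsGap G u' v')
    (ht : t ∈ Ioo u v) (ht' : t ∈ Icc u' v') : u' = u ∧ v' = v := by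
  have h1 : u' ≤ u := not_lt.1 fun hlt => h.2.2.2 u' h'.1 ⟨hlt, ht'.1.trans_lt ht.2⟩
  have h2 : v ≤ v' := not_lt.1 fun hlt => h.2.2.2 v' h'.2.1 ⟨ht.1.trans_le ht'.2, hlt⟩
  have h3 : u ≤ u' := not_lt.1 fun hlt => h'.2.2.2 u h.1 ⟨hlt, (ht.1.trans ht.2).trans_le h2⟩
  have h4 : v' ≤ v := not_lt.1 fun hlt =>
    h'.2.2.2 v h.2.1 ⟨h1.trans_lt (ht.1.trans ht.2), hlt⟩
  exact ⟨le_antisymm h1 h3, le_antisymm h4 h2⟩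

/-- During each gap of `G`, `c'` is constantly an entity that is most central among those which are
`ε`-connected to `c`. -/
def FollowsBest (X : MovingEntities n τ) (ε : ℝ) (G : Finset ℝ) (c c' : ℝ → Fin n) : Prop :=
  ∀ u v, IsGap G u v → ∃ ψ, ∀ t ∈ Ioo u v, c' t = ψ ∧ X.EpsConnected ε t (c t) ψ ∧
    ∀ ρ, X.EpsConnected ε t (c t) ρ → X.farDist ψ t ≤ X.farDist ρ t

/-- Rerouting a trajectoid gap by gap. -/
theorem IsTrajectoid.exists_followsBest (h : X.IsTrajectoid ε c) (hτ : 1 ≤ τ) {G : Finset ℝ}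
    (hG : X.IsSteadyCut ε G) : ∃ c', X.IsTrajectoid ε c' ∧ X.FollowsBest ε G c c' := by
  classical
  have key : ∀ A : Finset (ℝ × ℝ), (∀ p ∈ A, IsGap G p.1 p.2) → ∃ c', X.IsTrajectoid ε c' ∧
      (∀ u v, IsGap G u v → ∀ t ∈ Ioo u v, X.EpsConnected ε t (c t) (c' t)) ∧
      ∀ p ∈ A, ∃ ψ, ∀ t ∈ Ioo p.1 p.2, c' t = ψ ∧ X.EpsConnected ε t (c t) ψ ∧
        ∀ ρ, X.EpsConnected ε t (c t) ρ → X.farDist ψ t ≤ X.farDist ρ t := by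
    intro A
    induction A using Finset.induction_on with
    | empty => exact fun _ => ⟨c, h, fun _ _ _ _ _ => .refl _, by simp⟩
    | @insert p A hpA ih =>
      intro hA
      obtain ⟨u, v⟩ := p
      obtain ⟨c', hc', hcc', hbest⟩ := ih fun p hp => hA p (Finset.mem_insert_of_mem hp)
      have hgap : IsGap G u v := hA (u, v) (Finset.mem_insert_self _ _)
      have hu := hG.start_le hgap
      have hv := hG.le_finish hgap
      have huv := hgap.2.2.1
      obtain ⟨hP, hB⟩ := hG.steady_of_isGap hgap
      have hmid : (u + v) / 2 ∈ Ioo u v := ⟨by linarith, by linarith⟩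
      obtain ⟨ψ, hψ⟩ := hB (c ((u + v) / 2))
      have hcmid : ∀ t ∈ Ioo u v, X.EpsConnected ε t (c t) (c ((u + v) / 2)) := fun t ht =>
        FixedProximity.connected hP hmid ht (h.connected_of_fixedProximity hu hv hP ht hmid)
      have hcψ : ∀ t ∈ Ioo u v, X.EpsConnected ε t (c t) ψ := fun t ht =>
        (hcmid t ht).trans (hψ t ht).1
      refine ⟨(Icc u v).piecewise (fun _ => ψ) c', hc'.reroute hτ hu huv hv hP hmid
        ((hcc' u v hgap _ hmid).symm.trans (hψ _ hmid).1), ?_, ?_⟩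
      · intro u' v' hgap' t ht
        by_cases htm : t ∈ Icc u v
        · obtain ⟨rfl, rfl⟩ := hgap'.eq_of_mem hgap ht htm
          rw [piecewise_eq_of_mem _ _ _ htm]
          exact hcψ t ht
        · rw [piecewise_eq_of_notMem _ _ _ htm]
          exact hcc' u' v' hgap' t ht
      · intro p hp
        rcases Finset.mem_insert.1 hp with rfl | hp
        · refine ⟨ψ, fun t ht => ⟨piecewise_eq_of_mem _ _ _ (Ioo_subset_Icc_self ht), hcψ t ht,
            fun ρ hρ => (hψ t ht).2 ρ ((hcmid t ht).symm.trans hρ)⟩⟩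
        · have hgap' : IsGap G p.1 p.2 := hA p (Finset.mem_insert_of_mem hp)
          obtain ⟨ψ', hψ'⟩ := hbest p hp
          refine ⟨ψ', fun t ht => ⟨?_, (hψ' t ht).2⟩⟩
          rw [piecewise_eq_of_notMem _ _ _ fun htm => ?_]
          · exact (hψ' t ht).1
          · obtain ⟨h1, h2⟩ := hgap'.eq_of_mem hgap ht htm
            exact hpA (by rw [h1, h2]; exact hp)
  obtain ⟨c', hc', -, hbest⟩ := key ((G ×ˢ G).filter fun p => IsGap G p.1 p.2) (by simp)
  refine ⟨c', hc', fun u v hgap => hbest (u, v) ?_⟩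
  simp only [Finset.mem_filter, Finset.mem_product]
  exact ⟨⟨hgap.1, hgap.2.1⟩, hgap⟩

theorem FollowsBest.farDist_le {G : Finset ℝ} (h : X.FollowsBest ε G c c')
    (hG : X.IsSteadyCut ε G) {t : ℝ} (ht : t ∈ Ioo X.start X.finish) (htG : t ∉ G) {ρ : Fin n}
    (hρ : X.EpsConnected ε t (c t) ρ) : X.farDist (c' t) t ≤ X.farDist ρ t := by
  obtain ⟨u, v, hgap, htuv⟩ := hG.exists_isGap ht htG
  obtain ⟨ψ, hψ⟩ := h u v hgap
  obtain ⟨h1, -, h3⟩ := hψ t htuv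
  rw [h1]
  exact h3 ρ hρ

/-- `c` is constant on the gaps of `G`. -/
def ConstOnGaps (G : Finset ℝ) (c : ℝ → Fin n) : Prop :=
  ∀ u v, IsGap G u v → ∃ ψ, ∀ t ∈ Ioo u v, c t = ψ

theorem FollowsBest.constOnGaps {G : Finset ℝ} (h : X.FollowsBest ε G c c') :
    ConstOnGaps G c' := fun u v hgap => by
  obtain ⟨ψ, hψ⟩ := h u v hgap
  exact ⟨ψ, fun t ht => (hψ t ht).1⟩

theorem ConstOnGaps.complexity_le {G : Finset ℝ} (h : ConstOnGaps G c) (hG : X.IsSteadyCut ε G) :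
    X.complexity c ≤ ((τ + 1 + G.card : ℕ) : ℕ∞) := by
  have hsub : X.jumpTimes c ⊆ (G : Set ℝ) := by
    intro t ht
    by_contra htG
    obtain ⟨u, v, hgap, htuv⟩ := hG.exists_isGap ht.1 htG
    obtain ⟨ψ, hψ⟩ := h u v hgap
    refine ht.2 ?_
    filter_upwards [Ioo_mem_nhds htuv.1 htuv.2] with s hs
    rw [hψ s hs, hψ t htuv]
  have h1 : (range X.time).encard ≤ ((τ + 1 : ℕ) : ℕ∞) := by
    rw [← image_univ]
    refine (encard_image_le _ _).trans ?_
    rw [encard_univ, ENat.card_eq_coe_fintype_card, Fintype.card_fin]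
  refine (encard_union_le _ _).trans ?_
  rw [Nat.cast_add]
  refine add_le_add h1 ((encard_le_encard hsub).trans ?_)
  rw [encard_coe_eq_coe_finsetCard]

/-- A trajectoid that is constant on the gaps of `G` is given, up to finitely many times, by finitely
many values, so there are only finitely many costs to minimize over. -/
theorem exists_isCentral_constOnGaps (hn : 1 ≤ n) (hτ : 1 ≤ τ) {G : Finset ℝ}
    (hG : X.IsSteadyCut ε G) : ∃ c, X.IsCentral ε c ∧ ConstOnGaps G c := by
  classical
  set T : Set (ℝ → Fin n) := {c | X.IsTrajectoid ε c ∧ ConstOnGaps G c} with hT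
  have hdet : ∀ c ∈ T, ∀ c' ∈ T,
      (∀ u ∈ G, ∀ v ∈ G, c ((u + v) / 2) = c' ((u + v) / 2)) → X.cost c ≤ X.cost c' := by
    intro c hc c' hc' heq
    refine cost_le_cost hτ hc'.1 hc.1 (G := G) fun t ht htG => ?_
    obtain ⟨u, v, hgap, htuv⟩ := hG.exists_isGap ht htG
    obtain ⟨ψ, hψ⟩ := hc.2 u v hgap
    obtain ⟨ψ', hψ'⟩ := hc'.2 u v hgap
    have hmid : (u + v) / 2 ∈ Ioo u v := ⟨by linarith [hgap.2.2.1], by linarith [hgap.2.2.1]⟩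
    have := heq u hgap.1 v hgap.2.1
    rw [hψ _ hmid, hψ' _ hmid] at this
    rw [hψ t htuv, hψ' t htuv, this]
  have hfin : (X.cost '' T).Finite := by
    let f : T → ℝ := fun c => X.cost c.1
    let g : T → (G × G → Fin n) := fun c p => c.1 ((p.1.1 + p.2.1) / 2)
    have hfg : Function.FactorsThrough f g := by
      intro c c' heq
      have h1 : ∀ u ∈ G, ∀ v ∈ G, c.1 ((u + v) / 2) = c'.1 ((u + v) / 2) := fun u hu v hv =>
        congrFun heq (⟨u, hu⟩, ⟨v, hv⟩)
      exact le_antisymm (hdet _ c.2 _ c'.2 h1)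
        (hdet _ c'.2 _ c.2 fun u hu v hv => (h1 u hu v hv).symm)
    refine (finite_range (Function.extend g f 0)).subset ?_
    rintro _ ⟨c, hc, rfl⟩
    exact ⟨g ⟨c, hc⟩, hfg.extend_apply 0 ⟨c, hc⟩⟩
  have hne : (X.cost '' T).Nonempty :=
    ⟨_, mem_image_of_mem _ (show (fun _ => ⟨0, hn⟩) ∈ T from
      ⟨isTrajectoid_const _, fun _ _ _ => ⟨⟨0, hn⟩, fun _ _ => rfl⟩⟩)⟩
  obtain ⟨_, ⟨c, hc, rfl⟩, hmin⟩ := exists_min_image _ id hfin hne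
  refine ⟨c, ⟨hc.1, fun c' hc' => ?_⟩, hc.2⟩
  obtain ⟨c'', hc'', hb⟩ := hc'.exists_followsBest hτ hG
  refine (hmin _ ⟨c'', ⟨hc'', hb.constOnGaps⟩, rfl⟩).trans ?_
  exact cost_le_cost hτ hc' hc'' fun t ht htG => hb.farDist_le hG ht htG (.refl _)

/-- Without persistent ties, a central trajectory has no choice: it follows the best entity. -/
theorem NoPersistentTies.constOnGaps (hX : X.NoPersistentTies ε) (hτ : 1 ≤ τ) {G : Finset ℝ}
    (hG : X.IsSteadyCut ε G) (hc : X.IsCentral ε c) : ConstOnGaps G c := by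
  obtain ⟨c', hc', hb⟩ := hc.1.exists_followsBest hτ hG
  intro u v hgap
  obtain ⟨ψ, hψ⟩ := hb u v hgap
  have hu := hG.start_le hgap
  have hv := hG.le_finish hgap
  refine ⟨ψ, hc.1.eq_of_forall_subinterval hu hv fun ρ u' v' hu' huv' hv' hρ => ?_⟩
  by_contra hne
  obtain ⟨w, hw, hwρ⟩ := hX ρ ψ hne ((2 * u' + v') / 3) ((u' + 2 * v') / 3) (by linarith)
    (by linarith) (by linarith)
  have hw' : w ∈ Ioo u' v' := ⟨by linarith [hw.1], by linarith [hw.2]⟩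
  have hsub : Ioo u' v' ⊆ Ioo u v := Ioo_subset_Ioo hu' hv'
  have hsub' : Ioo u v ⊆ Icc X.start X.finish := fun t ht =>
    ⟨hu.trans ht.1.le, ht.2.le.trans hv⟩
  have hconn : ∀ t ∈ Ioo u' v', X.EpsConnected ε t ρ ψ := fun t ht => by
    have := (hψ t (hsub ht)).2.1
    rwa [hρ t ht] at this
  have hbest : ∀ t ∈ Ioo u' v', ∀ π, X.EpsConnected ε t ρ π → X.farDist ψ t ≤ X.farDist π t :=
    fun t ht => by
      have := (hψ t (hsub ht)).2.2
      rwa [hρ t ht] at this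
  have hlt : X.farDist ψ w < X.farDist ρ w := by
    by_contra! hle
    refine hwρ ⟨hconn w hw', fun π hπ => hle.trans (hbest w hw' π hπ), fun π hπ =>
      hbest w hw' π ((hconn w hw').trans hπ)⟩
  have hev : ∀ᶠ t in 𝓝 w, X.farDist ψ t < X.farDist ρ t := by
    have hmem : Icc X.start X.finish ∈ 𝓝 w :=
      mem_of_superset (Ioo_mem_nhds hw'.1 hw'.2) (hsub.trans hsub')
    exact ((X.continuousOn_farDist hτ ψ).continuousAt hmem).eventually_lt
      ((X.continuousOn_farDist hτ ρ).continuousAt hmem) hlt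
  obtain ⟨u₁, v₁, hw₁, hsub₁⟩ := mem_nhds_iff_exists_Ioo_subset.1
    (inter_mem hev (Ioo_mem_nhds hw'.1 hw'.2))
  have h₁ : ∀ t ∈ Ioo u₁ v₁, t ∈ Ioo u' v' := fun t ht => (hsub₁ ht).2
  have hle₁ := (Ioo_subset_Ioo_iff (hw₁.1.trans hw₁.2)).1 h₁
  obtain ⟨t, ht, -, heq⟩ := exists_farDist_eq hτ hc.1 hc'
    (fun t ht htG => hb.farDist_le hG ht htG (.refl _)) (hc.2 c' hc')
    (hu.trans (hu'.trans hle₁.1)) (hw₁.1.trans hw₁.2) (hle₁.2.trans (hv'.trans hv))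
  rw [(hψ t (hsub (h₁ t ht))).1, hρ t (h₁ t ht)] at heq
  exact absurd heq (hsub₁ ht).1.ne

theorem upper_bound (hn : 1 ≤ n) (hτ : 1 ≤ τ) (X : MovingEntities n τ) (ε : ℝ) :
    (∃ c : ℝ → Fin n, X.IsCentral ε c ∧ X.complexity c ≤ ((174 * τ * n ^ 2 : ℕ) : ℕ∞)) ∧
      (X.NoPersistentTies ε → ∀ c : ℝ → Fin n, X.IsCentral ε c →
        X.complexity c ≤ ((174 * τ * n ^ 2 : ℕ) : ℕ∞)) := by
  obtain ⟨G, hG, hcard⟩ := X.exists_isSteadyCut ε hn hτ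
  have hle : ((τ + 1 + G.card : ℕ) : ℕ∞) ≤ ((174 * τ * n ^ 2 : ℕ) : ℕ∞) := by
    have h1 : τ * 1 ≤ τ * n ^ 2 := Nat.mul_le_mul_left _ (Nat.one_le_pow _ _ hn)
    have h2 : 174 * τ * n ^ 2 = 174 * (τ * n ^ 2) := by ring
    exact_mod_cast (by omega : τ + 1 + G.card ≤ 174 * τ * n ^ 2)
  constructor
  · obtain ⟨c, hc, hconst⟩ := exists_isCentral_constOnGaps hn hτ hG
    exact ⟨c, hc, (hconst.complexity_le hG).trans hle⟩
  · exact fun hX c hc => ((hX.constOnGaps hτ hG hc).complexity_le hG).trans hle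

end MovingEntities

/-! ### Lines in general position -/

/-- Lines with different slopes can be shifted by arbitrarily small amounts so that no three of them
meet and no two pairs are at distance `1` at the same time: the shifts are chosen one after another,
and the pairs of earlier lines forbid only finitely many values for the next one. -/
theorem exists_shift_generalPosition (a b : ℕ → ℝ) {n : ℕ} {δ : ℝ} (hδ : 0 < δ)
    (hb : ∀ i < n, ∀ j < n, b i = b j → i = j) :
    ∃ x : ℕ → ℝ, (∀ k, x k ∈ Ioo 0 δ) ∧
      (∀ s i j l, i < j → j < l → l < n →
        ¬ (a i + x i + b i * s = a j + x j + b j * s ∧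
          a j + x j + b j * s = a l + x l + b l * s)) ∧
      ∀ s i j i' j', i < j → j < n → i' < j' → j' < n →
        |a i + x i + b i * s - (a j + x j + b j * s)| = 1 →
        |a i' + x i' + b i' * s - (a j' + x j' + b j' * s)| = 1 → i = i' ∧ j = j' := by
  classical
  suffices H : ∀ m ≤ n, ∃ x : ℕ → ℝ, (∀ k, x k ∈ Ioo 0 δ) ∧
      (∀ s i j l, i < j → j < l → l < m →
        ¬ (a i + x i + b i * s = a j + x j + b j * s ∧
          a j + x j + b j * s = a l + x l + b l * s)) ∧
      ∀ s i j i' j', i < j → j < m → i' < j' → j' < m →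
        |a i + x i + b i * s - (a j + x j + b j * s)| = 1 →
        |a i' + x i' + b i' * s - (a j' + x j' + b j' * s)| = 1 → i = i' ∧ j = j' from
    H n le_rfl
  intro m
  induction m with
  | zero =>
    exact fun _ => ⟨fun _ => δ / 2, fun _ => ⟨by linarith, by linarith⟩,
      fun _ _ _ _ _ _ h => absurd h (Nat.not_lt_zero _),
      fun _ _ _ _ _ _ h => absurd h (Nat.not_lt_zero _)⟩
  | succ m ih =>
    intro hm
    obtain ⟨x, hx, h3, h4⟩ := ih (by omega)
    set y : ℕ → ℝ → ℝ := fun i s => a i + x i + b i * s with hy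
    let R := Finset.range m
    let V : Finset ℝ := {0, 1, -1, 2, -2}
    -- the times at which two earlier lines are at distance `0`, `1` or `2`
    let S : Finset ℝ := ((R ×ˢ R) ×ˢ V).image fun q =>
      (q.2 - (a q.1.1 + x q.1.1 - (a q.1.2 + x q.1.2))) / (b q.1.1 - b q.1.2)
    let B : Finset ℝ := ((S ×ˢ R) ×ˢ V).image fun q => y q.1.2 q.1.1 + q.2 - a m - b m * q.1.1
    obtain ⟨z, hz, hzB⟩ := (Ioo_infinite hδ).exists_notMem_finset B
    have hS : ∀ s, ∀ i < m, ∀ j < m, i ≠ j → ∀ v ∈ V, y i s - y j s = v → s ∈ S := by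
      intro s i hi j hj hij v hv h
      refine Finset.mem_image.2 ⟨((i, j), v), by simp [R, hi, hj, hv], ?_⟩
      have hne : b i - b j ≠ 0 := sub_ne_zero.2 fun h => hij (hb i (by omega) j (by omega) h)
      rw [div_eq_iff hne, ← h]
      simp only [hy]
      ring
    have hB : ∀ s ∈ S, ∀ i < m, ∀ v ∈ V, a m + z + b m * s - y i s ≠ v := by
      intro s hs i hi v hv h
      refine hzB (Finset.mem_image.2 ⟨((s, i), v), by simp [R, hs, hi, hv], ?_⟩)
      simp only
      linarith
    have hV : ∀ r : ℝ, |r| = 1 → r = 1 ∨ r = -1 := fun r hr => eq_or_eq_neg_of_abs_eq hr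
    have hold : ∀ i < m, ∀ s, a i + Function.update x m z i + b i * s = y i s := by
      intro i hi s
      rw [Function.update_of_ne hi.ne]
    have hnew : ∀ s, a m + Function.update x m z m + b m * s = a m + z + b m * s := by
      intro s
      rw [Function.update_self]
    refine ⟨Function.update x m z, fun k => ?_, ?_, ?_⟩
    · rcases eq_or_ne k m with rfl | hk
      · rwa [Function.update_self]
      · rw [Function.update_of_ne hk]
        exact hx k
    · intro s i j l hij hjl hl
      rcases (Nat.lt_succ_iff.1 hl).lt_or_eq with hl | rfl
      · rw [hold i (by omega), hold j (by omega), hold l hl]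
        exact h3 s i j l hij hjl hl
      · rw [hold i (by omega), hold j hjl, hnew]
        rintro ⟨e1, e2⟩
        exact hB s (hS s i (by omega) j hjl hij.ne 0 (by simp [V]) (by linarith)) j hjl 0
          (by simp [V]) (by linarith)
    · intro s i j i' j' hij hj hij' hj'
      rcases (Nat.lt_succ_iff.1 hj).lt_or_eq with hj | rfl <;>
        rcases (Nat.lt_succ_iff.1 hj').lt_or_eq with hj' | rfl
      · rw [hold i (by omega), hold j hj, hold i' (by omega), hold j' hj']
        exact h4 s i j i' j' hij hj hij' hj'
      · rw [hold i (by omega), hold j hj, hold i' hij', hnew]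
        intro e1 e2
        exfalso
        have hs : s ∈ S := by
          rcases hV _ e1 with e | e
          · exact hS s i (by omega) j hj hij.ne 1 (by simp [V]) e
          · exact hS s i (by omega) j hj hij.ne (-1) (by simp [V]) e
        rcases hV _ e2 with e | e
        · exact hB s hs i' hij' (-1) (by simp [V]) (by linarith)
        · exact hB s hs i' hij' 1 (by simp [V]) (by linarith)
      · rw [hold i hij, hnew, hold i' (by omega), hold j' hj']
        intro e2 e1
        exfalso
        have hs : s ∈ S := by
          rcases hV _ e1 with e | e
          · exact hS s i' (by omega) j' hj' hij'.ne 1 (by simp [V]) e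
          · exact hS s i' (by omega) j' hj' hij'.ne (-1) (by simp [V]) e
        rcases hV _ e2 with e | e
        · exact hB s hs i hij (-1) (by simp [V]) (by linarith)
        · exact hB s hs i hij 1 (by simp [V]) (by linarith)
      · rw [hold i hij, hnew, hold i' hij']
        intro e1 e2
        refine ⟨?_, rfl⟩
        by_contra hne
        have hs : s ∈ S := by
          rcases hV _ e1 with e | e <;> rcases hV _ e2 with e' | e'
          · exact hS s i hij i' hij' hne 0 (by simp [V]) (by linarith)
          · exact hS s i hij i' hij' hne 2 (by simp [V]) (by linarith)
          · exact hS s i hij i' hij' hne (-2) (by simp [V]) (by linarith)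
          · exact hS s i hij i' hij' hne 0 (by simp [V]) (by linarith)
        rcases hV _ e1 with e | e
        · exact hB s hs i hij (-1) (by simp [V]) (by linarith)
        · exact hB s hs i hij 1 (by simp [V]) (by linarith)

/-! ### The zigzag of time -/

theorem exists_alternating_ramps {τ : ℕ} {time : Fin (τ + 1) → ℝ} (htime : StrictMono time) (S : ℝ) :
    ∃ φ : ℝ → ℝ, ∀ i : Fin τ,
      (∀ t ∈ Icc (time i.castSucc) (time i.succ),
        φ t = S * ((t - time i.castSucc) / (time i.succ - time i.castSucc))) ∨
      ∀ t ∈ Icc (time i.castSucc) (time i.succ),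
        φ t = S * ((time i.succ - t) / (time i.succ - time i.castSucc)) := by
  classical
  set f : Fin τ → ℝ → ℝ := fun i t => if Even (i : ℕ) then
    S * ((t - time i.castSucc) / (time i.succ - time i.castSucc)) else
    S * ((time i.succ - t) / (time i.succ - time i.castSucc)) with hf
  have hpos : ∀ i : Fin τ, 0 < time i.succ - time i.castSucc := fun i =>
    sub_pos.2 (htime (Fin.castSucc_lt_succ))
  have hlt : ∀ i j : Fin τ, i < j → ∀ t, t ∈ Icc (time i.castSucc) (time i.succ) →
      t ∈ Icc (time j.castSucc) (time j.succ) → f i t = f j t := by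
    intro i j hij t hi hj
    have h1 : i.succ ≤ j.castSucc := by
      rw [Fin.le_def, Fin.val_succ, Fin.val_castSucc]
      exact hij
    have h2 : i.succ = j.castSucc :=
      htime.injective (le_antisymm (htime.monotone h1) (hj.1.trans hi.2))
    have h3 : (j : ℕ) = i + 1 := by
      have := congrArg Fin.val h2
      rw [Fin.val_succ, Fin.val_castSucc] at this
      omega
    have h4 : t = time i.succ := le_antisymm hi.2 (by rw [h2]; exact hj.1)
    have hi' := (hpos i).ne'
    simp only [hf, h3, Nat.even_add_one]
    rw [h4, ← h2]
    by_cases he : Even (i : ℕ)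
    · simp [he, hi', (by have := (hpos j).ne'; rwa [← h2] at this : time j.succ - time i.succ ≠ 0)]
    · simp [he]
  have hcons : ∀ i j : Fin τ, ∀ t, t ∈ Icc (time i.castSucc) (time i.succ) →
      t ∈ Icc (time j.castSucc) (time j.succ) → f i t = f j t := by
    intro i j t hi hj
    rcases lt_trichotomy i j with h | rfl | h
    · exact hlt i j h t hi hj
    · rfl
    · exact (hlt j i h t hj hi).symm
  refine ⟨fun t => if h : ∃ i : Fin τ, t ∈ Icc (time i.castSucc) (time i.succ) then
    f h.choose t else 0, fun i => ?_⟩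
  have hφ : ∀ t ∈ Icc (time i.castSucc) (time i.succ), (if h : ∃ i : Fin τ,
      t ∈ Icc (time i.castSucc) (time i.succ) then f h.choose t else 0) = f i t := by
    intro t ht
    have h : ∃ i : Fin τ, t ∈ Icc (time i.castSucc) (time i.succ) := ⟨i, ht⟩
    rw [dif_pos h]
    exact hcons _ _ t h.choose_spec ht
  by_cases he : Even (i : ℕ)
  · exact Or.inl fun t ht => (hφ t ht).trans (by simp only [hf, if_pos he])
  · exact Or.inr fun t ht => (hφ t ht).trans (by simp only [hf, if_neg he])

/-- `φ` runs through `[0, S]` at constant speed, up or down, during each of the time intervals. -/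
structure IsZigzag {τ : ℕ} (time : Fin (τ + 1) → ℝ) (S : ℝ) (φ : ℝ → ℝ) : Prop where
  affine : ∀ i : Fin τ, ∃ α β : ℝ, ∀ t ∈ Icc (time i.castSucc) (time i.succ), φ t = α + β * t
  mem : ∀ i : Fin τ, ∀ t ∈ Icc (time i.castSucc) (time i.succ), φ t ∈ Icc 0 S
  strict : ∀ i : Fin τ, StrictMonoOn φ (Icc (time i.castSucc) (time i.succ)) ∨
    StrictAntiOn φ (Icc (time i.castSucc) (time i.succ))
  surj : ∀ i : Fin τ, ∀ s ∈ Ioo 0 S, ∃ t ∈ Ioo (time i.castSucc) (time i.succ), φ t = s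

theorem exists_isZigzag {τ : ℕ} {time : Fin (τ + 1) → ℝ} (htime : StrictMono time) {S : ℝ}
    (hS : 0 < S) : ∃ φ : ℝ → ℝ, IsZigzag time S φ := by
  obtain ⟨φ, hφ⟩ := exists_alternating_ramps htime S
  have hpos : ∀ i : Fin τ, 0 < time i.succ - time i.castSucc := fun i =>
    sub_pos.2 (htime (Fin.castSucc_lt_succ))
  have haff : ∀ i : Fin τ, ∃ α β : ℝ, (β = S / (time i.succ - time i.castSucc) ∧
      α = -(β * time i.castSucc) ∨ β = -(S / (time i.succ - time i.castSucc)) ∧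
      α = -(β * time i.succ)) ∧ ∀ t ∈ Icc (time i.castSucc) (time i.succ), φ t = α + β * t := by
    intro i
    rcases hφ i with h | h
    · refine ⟨_, _, Or.inl ⟨rfl, rfl⟩, fun t ht => ?_⟩
      rw [h t ht]
      ring
    · refine ⟨_, _, Or.inr ⟨rfl, rfl⟩, fun t ht => ?_⟩
      rw [h t ht]
      ring
  refine ⟨φ, fun i => ?_, fun i t ht => ?_, fun i => ?_, fun i s hs => ?_⟩
  · obtain ⟨α, β, -, h⟩ := haff i
    exact ⟨α, β, h⟩
  · have hi := hpos i
    rcases hφ i with h | h <;> rw [h t ht]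
    · exact ⟨mul_nonneg hS.le (div_nonneg (by linarith [ht.1]) hi.le),
        mul_le_of_le_one_right hS.le ((div_le_one hi).2 (by linarith [ht.2]))⟩
    · exact ⟨mul_nonneg hS.le (div_nonneg (by linarith [ht.2]) hi.le),
        mul_le_of_le_one_right hS.le ((div_le_one hi).2 (by linarith [ht.1]))⟩
  · obtain ⟨α, β, hβ, h⟩ := haff i
    have hq := div_pos hS (hpos i)
    rcases hβ with ⟨hβ, -⟩ | ⟨hβ, -⟩
    · left
      intro t ht t' ht' hlt
      rw [h t ht, h t' ht']
      have : 0 < β := hβ ▸ hq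
      linarith [mul_lt_mul_of_pos_left hlt this]
    · right
      intro t ht t' ht' hlt
      rw [h t ht, h t' ht']
      have : β < 0 := by rw [hβ]; linarith
      linarith [mul_lt_mul_of_neg_left hlt this]
  · have hi := hpos i
    have h0 : 0 < s / S * (time i.succ - time i.castSucc) := mul_pos (div_pos hs.1 hS) hi
    have h1 : s / S * (time i.succ - time i.castSucc) < time i.succ - time i.castSucc :=
      mul_lt_of_lt_one_left hi ((div_lt_one hS).2 hs.2)
    rcases hφ i with h | h
    · refine ⟨time i.castSucc + s / S * (time i.succ - time i.castSucc),
        ⟨by linarith, by linarith⟩, ?_⟩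
      rw [h _ ⟨by linarith, by linarith⟩]
      field_simp
      ring
    · refine ⟨time i.succ - s / S * (time i.succ - time i.castSucc),
        ⟨by linarith, by linarith⟩, ?_⟩
      rw [h _ ⟨by linarith, by linarith⟩]
      field_simp
      ring

/-! ### The lines of the lower bound construction -/

namespace ZigzagLines

/-- The slopes: `p` lines above tangent to the parabola `s²`, `p` lines below tangent to `-s²`, and
then `k` almost horizontal lines in the middle. -/
noncomputable def slope (p k σ : ℕ) : ℝ :=
  if σ < p then 4 * σ else if σ < 2 * p then -(4 * ((σ : ℝ) - p) + 2)
  else ((σ : ℝ) - 2 * p + 1) / (32 * k ^ 2 * p)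

/-- The values at `s = 0`. The parabolas are moved far up and far down by `20 p²`; the tangent points
are the even numbers `2 i` above and the odd numbers `2 j + 1` below; the lines in the middle are
`1 / k` apart and symmetric about `0`. -/
noncomputable def intercept (p k σ : ℕ) : ℝ :=
  if σ < p then 20 * p ^ 2 - 4 * σ ^ 2 else
  if σ < 2 * p then (2 * ((σ : ℝ) - p) + 1) ^ 2 - 20 * p ^ 2
  else (2 * ((σ : ℝ) - 2 * p) + 1 - k) / (2 * k)

/-- The lines, shifted by `x`. -/
noncomputable def line (p k : ℕ) (x : ℕ → ℝ) (σ : ℕ) (s : ℝ) : ℝ :=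
  intercept p k σ + x σ + slope p k σ * s

variable {p k : ℕ} {x : ℕ → ℝ} {s : ℝ}

theorem slope_top {i : ℕ} (hi : i < p) : slope p k i = 4 * i := by simp [slope, hi]

theorem slope_bottom {j : ℕ} (hj : j < p) : slope p k (p + j) = -(4 * j + 2) := by
  rw [slope, if_neg (by omega), if_pos (by omega)]
  push_cast
  ring

theorem slope_mid (l : ℕ) : slope p k (2 * p + l) = (l + 1) / (32 * k ^ 2 * p) := by
  rw [slope, if_neg (by omega), if_neg (by omega)]
  push_cast
  ring

theorem line_top {i : ℕ} (hi : i < p) :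
    line p k x i s = 20 * p ^ 2 + s ^ 2 - (s - 2 * i) ^ 2 + x i := by
  rw [line, slope_top hi, intercept, if_pos hi]
  ring

theorem line_bottom {j : ℕ} (hj : j < p) :
    line p k x (p + j) s = -(20 * p ^ 2) - s ^ 2 + (s - (2 * j + 1)) ^ 2 + x (p + j) := by
  rw [line, slope_bottom hj, intercept, if_neg (by omega), if_pos (by omega)]
  push_cast
  ring

theorem line_mid (l : ℕ) : line p k x (2 * p + l) s =
    (2 * l + 1 - k) / (2 * k) + x (2 * p + l) + (l + 1) / (32 * k ^ 2 * p) * s := by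
  rw [line, slope_mid, intercept, if_neg (by omega), if_neg (by omega)]
  push_cast
  ring

/-- Every index is that of a line above, below, or in the middle. -/
theorem cases_index {σ : ℕ} (hσ : σ < 2 * p + k) :
    σ < p ∨ (∃ j < p, σ = p + j) ∨ ∃ l < k, σ = 2 * p + l := by
  rcases lt_or_ge σ p with h | h
  · exact Or.inl h
  rcases lt_or_ge σ (2 * p) with h' | h'
  · exact Or.inr (Or.inl ⟨σ - p, by omega, by omega⟩)
  · exact Or.inr (Or.inr ⟨σ - 2 * p, by omega, by omega⟩)

theorem slope_mid_mem (hp : 1 ≤ p) {l : ℕ} (hl : l < k) :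
    slope p k (2 * p + l) ∈ Ioo (0 : ℝ) (1 / 2) := by
  have hp' : (1 : ℝ) ≤ p := by exact_mod_cast hp
  have hl' : (l : ℝ) + 1 ≤ k := by exact_mod_cast hl
  have hl0 : (0 : ℝ) ≤ l := l.cast_nonneg
  have hk' : (1 : ℝ) ≤ k := by linarith
  rw [slope_mid]
  have h1 : (k : ℝ) ≤ k ^ 2 * p := by nlinarith [mul_le_mul hk' hp' zero_le_one (by linarith)]
  refine ⟨by positivity, ?_⟩
  rw [div_lt_iff₀ (by positivity)]
  nlinarith

theorem slope_injOn (hp : 1 ≤ p) : ∀ σ < 2 * p + k, ∀ ψ < 2 * p + k,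
    slope p k σ = slope p k ψ → σ = ψ := by
  have htm : ∀ i < p, ∀ l < k, slope p k i ≠ slope p k (2 * p + l) := by
    intro i hi l hl h
    have h1 := slope_mid_mem hp hl
    rw [← h, slope_top hi] at h1
    have h2 : 0 < i := by
      have := h1.1
      exact_mod_cast (by linarith : (0 : ℝ) < i)
    have h3 : (1 : ℝ) ≤ i := by exact_mod_cast h2
    linarith [h1.2]
  have hneg : ∀ j < p, slope p k (p + j) < 0 := by
    intro j hj
    rw [slope_bottom hj]
    have : (0 : ℝ) ≤ j := j.cast_nonneg
    linarith
  have htop : ∀ i < p, 0 ≤ slope p k i := by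
    intro i hi
    rw [slope_top hi]
    positivity
  intro σ hσ ψ hψ h
  rcases cases_index hσ with hi | ⟨j, hj, rfl⟩ | ⟨l, hl, rfl⟩ <;>
    rcases cases_index hψ with hi' | ⟨j', hj', rfl⟩ | ⟨l', hl', rfl⟩
  · rw [slope_top hi, slope_top hi'] at h
    exact_mod_cast (by linarith : (σ : ℝ) = ψ)
  · linarith [hneg j' hj', htop σ hi]
  · exact absurd h (htm σ hi l' hl')
  · linarith [hneg j hj, htop ψ hi']
  · rw [slope_bottom hj, slope_bottom hj'] at h
    have : j = j' := by exact_mod_cast (by linarith : (j : ℝ) = j')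
    rw [this]
  · linarith [hneg j hj, (slope_mid_mem hp hl').1]
  · exact absurd h.symm (htm ψ hi' l hl)
  · linarith [hneg j' hj', (slope_mid_mem hp hl).1]
  · rw [slope_mid, slope_mid] at h
    have hk : (0 : ℝ) < k := by exact_mod_cast (by omega : 0 < k)
    have hp' : (0 : ℝ) < p := by exact_mod_cast hp
    rw [div_left_inj' (by positivity)] at h
    have : l = l' := by exact_mod_cast (by linarith : (l : ℝ) = l')
    rw [this]

/-- Both lines are above, both are below, or both are in the middle. -/
def SameKind (p σ ψ : ℕ) : Prop := (σ < p ↔ ψ < p) ∧ (σ < 2 * p ↔ ψ < 2 * p)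

/-- The slopes of a line above and of a line below add up to `2` modulo `4`, unlike those of two
lines of the same kind. -/
theorem slope_add_ne (hp : 1 ≤ p) {σ ψ : ℕ} (hσ : σ < 2 * p + k) (hψ : ψ < 2 * p + k)
    (hkind : SameKind p σ ψ) {i j : ℕ} (hi : i < p) (hj : j < p) :
    slope p k σ + slope p k ψ ≠ slope p k i + slope p k (p + j) := by
  intro h
  rw [slope_top hi, slope_bottom hj] at h
  obtain ⟨h1, h2⟩ := hkind
  rcases cases_index hσ with hi' | ⟨j', hj', rfl⟩ | ⟨l, hl, rfl⟩
  · rw [slope_top hi', slope_top (h1.1 hi')] at h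
    have h' : (4 * σ + 4 * ψ + 4 * j + 2 : ℝ) = 4 * i := by linarith
    have h'' : 4 * σ + 4 * ψ + 4 * j + 2 = 4 * i := by exact_mod_cast h'
    omega
  · obtain ⟨j'', rfl⟩ : ∃ j'', ψ = p + j'' := ⟨ψ - p, by omega⟩
    rw [slope_bottom hj', slope_bottom (by omega)] at h
    have h' : (4 * j : ℝ) = 4 * i + 4 * j' + 4 * j'' + 2 := by linarith
    have h'' : 4 * j = 4 * i + 4 * j' + 4 * j'' + 2 := by exact_mod_cast h'
    omega
  · obtain ⟨l', rfl⟩ : ∃ l', ψ = 2 * p + l' := ⟨ψ - 2 * p, by omega⟩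
    have e1 := slope_mid_mem hp hl
    have e2 := slope_mid_mem (k := k) (l := l') hp (by omega)
    have h3 : (4 * j : ℝ) < 4 * i + 0 := by linarith [e1.2, e2.2, e1.1, e2.1]
    have h4 : (4 * i : ℝ) < 4 * j + 3 := by linarith [e1.2, e2.2, e1.1, e2.1]
    have h5 : 4 * j < 4 * i + 0 := by exact_mod_cast h3
    have h6 : 4 * i < 4 * j + 3 := by exact_mod_cast h4
    omega

/-! ### Estimates for the lines -/

theorem line_top_mem (hs : s ∈ Icc (0 : ℝ) (2 * p)) (hk : 1 ≤ k)
    (hx : ∀ σ, x σ ∈ Ioo (0 : ℝ) (1 / (16 * k))) {i : ℕ} (hi : i < p) :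
    line p k x i s ∈ Icc (16 * p ^ 2 : ℝ) (24 * p ^ 2 + 1) := by
  have hk' : (1 : ℝ) ≤ k := by exact_mod_cast hk
  have hx1 : x i < 1 := (hx i).2.trans (by rw [div_lt_one (by positivity)]; linarith)
  have hi' : (i : ℝ) ≤ p := by exact_mod_cast hi.le
  have hi0 : (0 : ℝ) ≤ i := i.cast_nonneg
  rw [line_top hi]
  constructor
  · nlinarith [(hx i).1, mul_nonneg hi0 hs.1, mul_nonneg (sub_nonneg.2 hi') hi0]
  · nlinarith [sq_nonneg (s - 2 * i), mul_nonneg (sub_nonneg.2 hs.2) hs.1, hs.2]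

theorem line_bottom_mem (hs : s ∈ Icc (0 : ℝ) (2 * p)) (hk : 1 ≤ k)
    (hx : ∀ σ, x σ ∈ Ioo (0 : ℝ) (1 / (16 * k))) {j : ℕ} (hj : j < p) :
    line p k x (p + j) s ∈ Icc (-(24 * p ^ 2) : ℝ) (-(16 * p ^ 2) + 1) := by
  have hk' : (1 : ℝ) ≤ k := by exact_mod_cast hk
  have hx1 : x (p + j) < 1 := (hx _).2.trans (by rw [div_lt_one (by positivity)]; linarith)
  have hj' : (j : ℝ) + 1 ≤ p := by exact_mod_cast hj
  have hj0 : (0 : ℝ) ≤ j := j.cast_nonneg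
  rw [line_bottom hj]
  constructor
  · nlinarith [(hx (p + j)).1, sq_nonneg (s - (2 * j + 1)), mul_nonneg (sub_nonneg.2 hs.2) hs.1,
      hs.2]
  · nlinarith [mul_nonneg (by linarith : (0 : ℝ) ≤ 2 * j + 1) hs.1,
      mul_nonneg (by linarith : (0 : ℝ) ≤ 2 * p - (2 * j + 1)) (by linarith : (0 : ℝ) ≤ 2 * j + 1),
      mul_nonneg (by linarith : (0 : ℝ) ≤ 2 * p - (2 * j + 1)) (by linarith : (0 : ℝ) ≤ 2 * p)]

/-- The lines in the middle stay near their levels. -/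
theorem line_mid_mem (hp : 1 ≤ p) (hs : s ∈ Icc (0 : ℝ) (2 * p))
    (hx : ∀ σ, x σ ∈ Ioo (0 : ℝ) (1 / (16 * k))) {l : ℕ} (hl : l < k) :
    line p k x (2 * p + l) s ∈ Icc ((2 * l + 1 - k) / (2 * k) : ℝ)
      ((2 * l + 1 - k) / (2 * k) + 1 / (8 * k)) := by
  have hp' : (1 : ℝ) ≤ p := by exact_mod_cast hp
  have hl' : (l : ℝ) + 1 ≤ k := by exact_mod_cast hl
  have hl0 : (0 : ℝ) ≤ l := l.cast_nonneg
  have hk : (1 : ℝ) ≤ k := by linarith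
  have h1 : (0 : ℝ) ≤ (l + 1) / (32 * k ^ 2 * p) * s := mul_nonneg (by positivity) hs.1
  have h2 : ((l : ℝ) + 1) / (32 * k ^ 2 * p) * s ≤ 1 / (16 * k) := by
    have h : ((l : ℝ) + 1) / (32 * (k : ℝ) ^ 2 * p) * s ≤
        (k : ℝ) / (32 * (k : ℝ) ^ 2 * p) * (2 * p) :=
      mul_le_mul (by gcongr) hs.2 hs.1 (by positivity)
    refine h.trans_eq ?_
    field_simp
    norm_num
  have h3 : (1 : ℝ) / (8 * k) = 1 / (16 * k) + 1 / (16 * k) := by field_simp; norm_num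
  rw [line_mid]
  constructor
  · linarith [(hx (2 * p + l)).1]
  · linarith [(hx (2 * p + l)).2]

theorem level_mem {l : ℕ} (hl : l < k) :
    ((2 * l + 1 - k) / (2 * k) : ℝ) ∈ Icc (-(1 / 2) + 1 / (2 * k) : ℝ) (1 / 2 - 1 / (2 * k)) := by
  have hl' : (l : ℝ) + 1 ≤ k := by exact_mod_cast hl
  have hl0 : (0 : ℝ) ≤ l := l.cast_nonneg
  have hk : (0 : ℝ) < k := by linarith
  have h1 : (-(1 / 2) + 1 / (2 * k) : ℝ) = (-k + 1) / (2 * k) := by field_simp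
  have h2 : (1 / 2 - 1 / (2 * k) : ℝ) = (k - 1) / (2 * k) := by field_simp
  rw [h1, h2]
  constructor <;> rw [div_le_div_iff_of_pos_right (by positivity)] <;> linarith

theorem line_mid_mem_unit (hp : 1 ≤ p) (hs : s ∈ Icc (0 : ℝ) (2 * p))
    (hx : ∀ σ, x σ ∈ Ioo (0 : ℝ) (1 / (16 * k))) {l : ℕ} (hl : l < k) :
    line p k x (2 * p + l) s ∈ Icc (-(1 / 2) : ℝ) (1 / 2) := by
  have h1 := line_mid_mem hp hs hx hl
  have h2 := level_mem hl
  have hk : (0 : ℝ) < k := by exact_mod_cast (by omega : 0 < k)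
  have h3 : (1 : ℝ) / (2 * k) = 4 * (1 / (8 * k)) := by field_simp; norm_num
  have h4 : (0 : ℝ) < 1 / (8 * k) := by positivity
  exact ⟨by linarith [h1.1, h2.1], by linarith [h1.2, h2.2]⟩

/-- Lines of different kinds are far apart. -/
theorem sameKind_of_abs_sub_le (hp : 1 ≤ p) (hk : 1 ≤ k) (hs : s ∈ Icc (0 : ℝ) (2 * p))
    (hx : ∀ σ, x σ ∈ Ioo (0 : ℝ) (1 / (16 * k))) {σ ψ : ℕ} (hσ : σ < 2 * p + k)
    (hψ : ψ < 2 * p + k) (h : |line p k x σ s - line p k x ψ s| ≤ 1) : SameKind p σ ψ := by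
  have hp' : (1 : ℝ) ≤ p := by exact_mod_cast hp
  have hp2 : (1 : ℝ) ≤ p ^ 2 := by nlinarith
  rw [abs_le] at h
  obtain ⟨h1, h2⟩ := h
  rcases cases_index hσ with hi | ⟨j, hj, rfl⟩ | ⟨l, hl, rfl⟩ <;>
    rcases cases_index hψ with hi' | ⟨j', hj', rfl⟩ | ⟨l', hl', rfl⟩
  · constructor <;> omega
  · linarith [(line_top_mem hs hk hx hi).1, (line_bottom_mem hs hk hx hj').2]
  · linarith [(line_top_mem hs hk hx hi).1, (line_mid_mem_unit hp hs hx hl').2]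
  · linarith [(line_top_mem hs hk hx hi').1, (line_bottom_mem hs hk hx hj).2]
  · constructor <;> omega
  · linarith [(line_mid_mem_unit hp hs hx hl').1, (line_bottom_mem hs hk hx hj).2]
  · linarith [(line_top_mem hs hk hx hi').1, (line_mid_mem_unit hp hs hx hl).2]
  · linarith [(line_mid_mem_unit hp hs hx hl).1, (line_bottom_mem hs hk hx hj').2]
  · constructor <;> omega

/-- The bound is below the distance between the two outer families, see `exists_far_of_not_mid`. -/
theorem abs_mid_sub_le (hp : 1 ≤ p) (hk : 1 ≤ k) (hs : s ∈ Icc (0 : ℝ) (2 * p))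
    (hx : ∀ σ, x σ ∈ Ioo (0 : ℝ) (1 / (16 * k))) {l ψ : ℕ} (hl : l < k) (hψ : ψ < 2 * p + k) :
    |line p k x (2 * p + l) s - line p k x ψ s| ≤ 24 * p ^ 2 + 2 := by
  have hp2 : (0 : ℝ) ≤ p ^ 2 := by positivity
  have hm := line_mid_mem_unit hp hs hx hl
  rw [abs_le]
  rcases cases_index hψ with hi' | ⟨j', hj', rfl⟩ | ⟨l', hl', rfl⟩
  · have := line_top_mem hs hk hx hi'
    exact ⟨by linarith [hm.1, this.2], by linarith [hm.2, this.1]⟩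
  · have := line_bottom_mem hs hk hx hj'
    exact ⟨by linarith [hm.1, this.2], by linarith [hm.2, this.1]⟩
  · have := line_mid_mem_unit hp hs hx hl'
    exact ⟨by linarith [hm.1, this.2], by linarith [hm.2, this.1]⟩

theorem exists_far_of_not_mid (hp : 1 ≤ p) (hk : 1 ≤ k) (hs : s ∈ Icc (0 : ℝ) (2 * p))
    (hx : ∀ σ, x σ ∈ Ioo (0 : ℝ) (1 / (16 * k))) {ρ : ℕ} (hρ : ρ < 2 * p) :
    ∃ ψ < 2 * p, 24 * (p : ℝ) ^ 2 + 2 < |line p k x ρ s - line p k x ψ s| := by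
  have hp' : (1 : ℝ) ≤ p := by exact_mod_cast hp
  have hp2 : (1 : ℝ) ≤ p ^ 2 := by nlinarith
  have h0 := line_top_mem hs hk hx (i := 0) (by omega)
  have h1 := line_bottom_mem hs hk hx (j := 0) (by omega)
  rcases cases_index (k := k) (hρ.trans_le (Nat.le_add_right _ _)) with hi | ⟨j, hj, rfl⟩ | ⟨l, hl, rfl⟩
  · refine ⟨p + 0, by omega, lt_of_lt_of_le ?_ (le_abs_self _)⟩
    linarith [h1.2, (line_top_mem hs hk hx hi).1]
  · refine ⟨0, by omega, lt_of_lt_of_le ?_ (neg_le_abs _)⟩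
    linarith [h0.1, (line_bottom_mem hs hk hx hj).2]
  · omega

/-- The time in `[2 i, 2 i + 1]` at which the midpoint between the parabolas' tangents is at the
level of the `l`-th line in the middle. -/
noncomputable def sample (k i l : ℕ) : ℝ := 2 * i + 1 - (2 * l + 1) / (2 * k)

theorem sample_mem {i l : ℕ} (hl : l < k) : sample k i l ∈ Ioo (2 * i : ℝ) (2 * i + 1) := by
  have hl' : (l : ℝ) + 1 ≤ k := by exact_mod_cast hl
  have hl0 : (0 : ℝ) ≤ l := l.cast_nonneg
  have hk : (0 : ℝ) < k := by linarith
  rw [sample]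
  have h1 : (2 * l + 1 : ℝ) / (2 * k) < 1 := by rw [div_lt_one (by positivity)]; linarith
  have h2 : 0 < (2 * l + 1 : ℝ) / (2 * k) := by positivity
  exact ⟨by linarith, by linarith⟩

/-- At the sample time of the `l`-th line in the middle, this line has all lines within distance
`r`, and every other line has some line farther away than `r`. -/
theorem exists_radius_of_sample (hp : 1 ≤ p) (hk : 1 ≤ k)
    (hx : ∀ σ, x σ ∈ Ioo (0 : ℝ) (1 / (16 * k))) {i l : ℕ} (hi : i < p) (hl : l < k) :
    ∃ r : ℝ, (∀ ψ < 2 * p + k,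
        |line p k x (2 * p + l) (sample k i l) - line p k x ψ (sample k i l)| ≤ r) ∧
      ∀ ρ < 2 * p + k, ρ ≠ 2 * p + l → ∃ ψ < 2 * p + k,
        r < |line p k x ρ (sample k i l) - line p k x ψ (sample k i l)| := by
  have hmem := sample_mem (i := i) hl
  set s := sample k i l with hs_def
  have hk' : (1 : ℝ) ≤ k := by exact_mod_cast hk
  have hp' : (1 : ℝ) ≤ p := by exact_mod_cast hp
  have hi' : (i : ℝ) + 1 ≤ p := by exact_mod_cast hi
  have hi0 : (0 : ℝ) ≤ i := i.cast_nonneg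
  have hs : s ∈ Icc (0 : ℝ) (2 * p) := ⟨by linarith [hmem.1], by linarith [hmem.2]⟩
  set w : ℝ := 1 / (16 * k) with hw
  have hw0 : 0 < w := by positivity
  have hw1 : w ≤ 1 / 16 := by
    rw [hw, div_le_div_iff₀ (by positivity) (by norm_num)]
    linarith
  have hw8 : (1 : ℝ) / (8 * k) = 2 * w := by rw [hw]; field_simp; norm_num
  set e : ℝ := s - 2 * i with he
  have he0 : 0 < e := by linarith [hmem.1]
  have he1 : e < 1 := by linarith [hmem.2]
  -- the level of the chosen line is the midpoint between the nearest tangents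
  have hlev : (2 * l + 1 - k : ℝ) / (2 * k) = (1 - 2 * e) / 2 := by
    rw [he, hs_def, sample]
    field_simp
    ring
  set m : ℝ := (1 - 2 * e) / 2 with hm
  set r : ℝ := 20 * p ^ 2 + s ^ 2 - e ^ 2 - m with hr
  have hr' : m - r = -(20 * p ^ 2) - s ^ 2 + (1 - e) ^ 2 := by rw [hr, hm]; ring
  have hp2 : (1 : ℝ) ≤ p ^ 2 := by nlinarith
  have hr1 : 10 ≤ r := by
    have : e ^ 2 ≤ 1 := pow_le_one₀ he0.le he1.le
    linarith [sq_nonneg s]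
  have hmid : ∀ l' < k, line p k x (2 * p + l') s ∈
      Icc (m + ((l' : ℝ) - l) * (16 * w)) (m + ((l' : ℝ) - l) * (16 * w) + 2 * w) := by
    intro l' hl'
    have := line_mid_mem hp hs hx hl'
    have hl2 : (2 * l' + 1 - k : ℝ) / (2 * k) = m + ((l' : ℝ) - l) * (16 * w) := by
      rw [← hlev, hw]
      field_simp
      ring
    rwa [hl2, hw8] at this
  have hself : line p k x (2 * p + l) s ∈ Icc m (m + 2 * w) := by
    have := hmid l hl
    rwa [sub_self, zero_mul, add_zero] at this
  have hunit := line_mid_mem_unit hp hs hx hl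
  have htop : ∀ i' < p, line p k x i' s ≤ m + r + w := by
    intro i' hi'
    rw [line_top hi']
    have h1 : e ^ 2 ≤ (s - 2 * i') ^ 2 := by
      rcases lt_trichotomy i' i with h | rfl | h
      · have : (i' : ℝ) + 1 ≤ i := by exact_mod_cast h
        exact sq_le_sq.2 (abs_le_abs (by linarith) (by linarith))
      · exact le_rfl
      · have : (i : ℝ) + 1 ≤ i' := by exact_mod_cast h
        rw [← neg_sq (s - 2 * (i' : ℝ))]
        exact sq_le_sq.2 (abs_le_abs (by linarith) (by linarith))
    linarith [(hx i').2]
  have hbot : ∀ j' < p, m - r ≤ line p k x (p + j') s := by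
    intro j' hj'
    rw [line_bottom hj', hr']
    have h1 : (1 - e) ^ 2 ≤ (s - (2 * j' + 1)) ^ 2 := by
      rcases lt_trichotomy j' i with h | rfl | h
      · have : (j' : ℝ) + 1 ≤ i := by exact_mod_cast h
        exact sq_le_sq.2 (abs_le_abs (by linarith) (by linarith))
      · rw [he]
        exact le_of_eq (by ring)
      · have : (i : ℝ) + 1 ≤ j' := by exact_mod_cast h
        rw [← neg_sq (s - (2 * (j' : ℝ) + 1))]
        exact sq_le_sq.2 (abs_le_abs (by linarith) (by linarith))
    linarith [(hx (p + j')).1]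
  have htop_i : m + r ≤ line p k x i s := by
    rw [line_top hi]
    linarith [(hx i).1]
  have hbot_i : line p k x (p + i) s ≤ m - r + w := by
    have h1 : (s - (2 * i + 1)) ^ 2 = (1 - e) ^ 2 := by rw [he]; ring
    rw [line_bottom hi, hr', h1]
    linarith [(hx (p + i)).2]
  refine ⟨r + 2 * w, fun ψ hψ => abs_le.2 ?_, fun ρ hρ hne => ?_⟩
  · rcases cases_index hψ with hi' | ⟨j', hj', rfl⟩ | ⟨l', hl', rfl⟩
    · have h1 := (line_top_mem hs hk hx hi').1
      exact ⟨by linarith [htop ψ hi', hself.1], by linarith [hunit.2]⟩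
    · have h1 := (line_bottom_mem hs hk hx hj').2
      exact ⟨by linarith [hunit.1], by linarith [hbot j' hj', hself.2]⟩
    · have h1 := line_mid_mem_unit hp hs hx hl'
      exact ⟨by linarith [hunit.1, h1.2], by linarith [hunit.2, h1.1]⟩
  · rcases lt_or_ge ρ (2 * p) with hρ' | hρ'
    · obtain ⟨ψ, hψ, hlt⟩ := exists_far_of_not_mid hp hk hs hx hρ'
      refine ⟨ψ, by omega, lt_of_le_of_lt ?_ hlt⟩
      have hs2 : s ^ 2 ≤ (2 * p) ^ 2 := pow_le_pow_left₀ hs.1 hs.2 2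
      rw [mul_pow] at hs2
      linarith [sq_nonneg e]
    · obtain ⟨l', rfl⟩ : ∃ l', ρ = 2 * p + l' := ⟨ρ - 2 * p, by omega⟩
      have hmem' := hmid l' (by omega)
      rcases lt_or_gt_of_ne (fun h => hne (by rw [h]) : l' ≠ l) with h | h
      · have : (l' : ℝ) + 1 ≤ l := by exact_mod_cast h
        refine ⟨i, by omega, lt_of_lt_of_le ?_ (neg_le_abs _)⟩
        have h2 : ((l' : ℝ) - l) * (16 * w) ≤ -1 * (16 * w) :=
          mul_le_mul_of_nonneg_right (by linarith) (by linarith)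
        linarith [hmem'.2]
      · have : (l : ℝ) + 1 ≤ l' := by exact_mod_cast h
        refine ⟨p + i, by omega, lt_of_lt_of_le ?_ (le_abs_self _)⟩
        have h2 : 1 * (16 * w) ≤ ((l' : ℝ) - l) * (16 * w) :=
          mul_le_mul_of_nonneg_right (by linarith) (by linarith)
        linarith [hmem'.1]

end ZigzagLines

namespace MovingEntities

variable {n τ : ℕ} {X : MovingEntities n τ} {ε u v : ℝ} {c : ℝ → Fin n}

/-! ### The lower bound construction -/

open ZigzagLines in
/-- The entities of `X` move along the lines of `ZigzagLines`, scaled by `ε`, with the time `s` of the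
lines running back and forth through `[0, 2 p]` once for each time interval of `X`. -/
structure IsZigzagMotion (X : MovingEntities n τ) (ε : ℝ) (p k : ℕ) (x : ℕ → ℝ) (φ : ℝ → ℝ) :
    Prop where
  card_eq : n = 2 * p + k
  one_le_p : 1 ≤ p
  one_le_k : 1 ≤ k
  one_le_τ : 1 ≤ τ
  eps_pos : 0 < ε
  shift_mem : ∀ σ, x σ ∈ Ioo (0 : ℝ) (1 / (16 * k))
  zigzag : IsZigzag X.time (2 * p) φ
  pos_eq : ∀ σ t, X.pos σ t = ε * line p k x σ (φ t)

namespace IsZigzagMotion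

open ZigzagLines

variable {p k : ℕ} {x : ℕ → ℝ} {φ : ℝ → ℝ}

theorem phi_mem (h : X.IsZigzagMotion ε p k x φ) {t : ℝ} (ht : t ∈ Icc X.start X.finish) :
    φ t ∈ Icc (0 : ℝ) (2 * p) := by
  obtain ⟨i, hi⟩ := X.exists_mem_Icc_piece h.one_le_τ ht
  exact h.zigzag.mem i t hi

theorem lt_card (h : X.IsZigzagMotion ε p k x φ) (σ : Fin n) : (σ : ℕ) < 2 * p + k :=
  σ.2.trans_eq h.card_eq

theorem abs_sub_eq (h : X.IsZigzagMotion ε p k x φ) (σ ψ : Fin n) (t : ℝ) :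
    |X.pos σ t - X.pos ψ t| = ε * |line p k x σ (φ t) - line p k x ψ (φ t)| := by
  rw [h.pos_eq, h.pos_eq, ← mul_sub, abs_mul, abs_of_pos h.eps_pos]

theorem abs_sub_le_iff (h : X.IsZigzagMotion ε p k x φ) (σ ψ : Fin n) (t : ℝ) :
    |X.pos σ t - X.pos ψ t| ≤ ε ↔ |line p k x σ (φ t) - line p k x ψ (φ t)| ≤ 1 := by
  rw [h.abs_sub_eq, mul_le_iff_le_one_right h.eps_pos]

theorem sameKind (h : X.IsZigzagMotion ε p k x φ) {σ ψ : Fin n} {t : ℝ}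
    (ht : t ∈ Icc X.start X.finish) (hc : X.EpsConnected ε t σ ψ) : SameKind p σ ψ := by
  induction hc with
  | refl => exact ⟨Iff.rfl, Iff.rfl⟩
  | @tail b c _ hbc ih =>
    have := sameKind_of_abs_sub_le h.one_le_p h.one_le_k (h.phi_mem ht) h.shift_mem (h.lt_card b)
      (h.lt_card c) ((h.abs_sub_le_iff b c t).1 hbc)
    exact ⟨ih.1.trans this.1, ih.2.trans this.2⟩

/-- The `l`-th entity in the middle. -/
def mid (h : X.IsZigzagMotion ε p k x φ) (l : ℕ) (hl : l < k) : Fin n :=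
  ⟨2 * p + l, by rw [h.card_eq]; omega⟩

theorem mid_connected (h : X.IsZigzagMotion ε p k x φ) {l l' : ℕ} (hl : l < k) (hl' : l' < k)
    {t : ℝ} (ht : t ∈ Icc X.start X.finish) :
    X.EpsConnected ε t (h.mid l hl) (h.mid l' hl') := by
  refine .single ((h.abs_sub_le_iff _ _ t).2 (abs_le.2 ?_))
  have h1 := line_mid_mem_unit h.one_le_p (h.phi_mem ht) h.shift_mem hl
  have h2 := line_mid_mem_unit h.one_le_p (h.phi_mem ht) h.shift_mem hl'
  exact ⟨by simp only [mid]; linarith [h1.1, h2.2], by simp only [mid]; linarith [h1.2, h2.1]⟩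

theorem farDist_mid_le (h : X.IsZigzagMotion ε p k x φ) {l : ℕ} (hl : l < k) {t : ℝ}
    (ht : t ∈ Icc X.start X.finish) {ρ : Fin n} (hρ : (ρ : ℕ) < 2 * p) :
    X.farDist (h.mid l hl) t ≤ X.farDist ρ t := by
  have hφ := h.phi_mem ht
  obtain ⟨ψ, hψ, hlt⟩ := exists_far_of_not_mid h.one_le_p h.one_le_k hφ h.shift_mem hρ
  have hψn : ψ < n := by rw [h.card_eq]; omega
  refine le_trans (farDist_le fun π => ?_) (abs_le_farDist ρ ⟨ψ, hψn⟩)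
  rw [h.abs_sub_eq, h.abs_sub_eq]
  refine mul_le_mul_of_nonneg_left (le_trans ?_ hlt.le) h.eps_pos.le
  exact abs_mid_sub_le h.one_le_p h.one_le_k hφ h.shift_mem hl (h.lt_card π)

theorem farDist_lt_of_sample (h : X.IsZigzagMotion ε p k x φ) {i l : ℕ} (hi : i < p) (hl : l < k)
    {t : ℝ} (ht : φ t = sample k i l) {ρ : Fin n} (hρ : ρ ≠ h.mid l hl) :
    X.farDist (h.mid l hl) t < X.farDist ρ t := by
  obtain ⟨r, hr, hr'⟩ := exists_radius_of_sample h.one_le_p h.one_le_k h.shift_mem hi hl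
  obtain ⟨ψ, hψ, hlt⟩ := hr' ρ (h.lt_card ρ) fun he => hρ (Fin.ext he)
  have hψn : ψ < n := by rw [h.card_eq]; omega
  refine lt_of_le_of_lt (b := ε * r) (farDist_le fun π => ?_)
    (lt_of_lt_of_le ?_ (abs_le_farDist ρ ⟨ψ, hψn⟩))
  · rw [h.abs_sub_eq, ht]
    exact mul_le_mul_of_nonneg_left (hr π (h.lt_card π)) h.eps_pos.le
  · rw [h.abs_sub_eq, ht]
    exact mul_lt_mul_of_pos_left hlt h.eps_pos

/-- Two different entities of the same kind cannot tie at two different times of the same time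
interval with the same topmost and bottommost entities: this would determine the sum of their
slopes. -/
theorem noPersistentTies (h : X.IsZigzagMotion ε p k x φ) : X.NoPersistentTies ε := by
  intro σ ψ hσψ u v hu huv hv
  by_contra! hcon
  have : Nonempty (Fin n) := ⟨σ⟩
  have hsub : Icc u v ⊆ Icc X.start X.finish := Icc_subset_Icc hu hv
  have hkind : SameKind p σ ψ :=
    h.sameKind (hsub ⟨le_rfl, huv.le⟩) (hcon u ⟨le_rfl, huv.le⟩).1
  have hslope : slope p k σ ≠ slope p k ψ := fun he =>
    hσψ (Fin.ext (slope_injOn h.one_le_p _ (h.lt_card σ) _ (h.lt_card ψ) he))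
  -- at each time, the entities meet or are opposite with respect to top and bottom
  have hlab : ∀ t : Icc u v, ∃ lab : Fin τ × (Option (Fin n × Fin n)),
      (t : ℝ) ∈ Icc (X.time lab.1.castSucc) (X.time lab.1.succ) ∧
      match lab.2 with
      | none => line p k x σ (φ t) = line p k x ψ (φ t)
      | some (a, b) => (a : ℕ) < p ∧ (∃ j < p, (b : ℕ) = p + j) ∧
          line p k x σ (φ t) + line p k x ψ (φ t) = line p k x a (φ t) + line p k x b (φ t) := by
    rintro ⟨t, ht⟩
    obtain ⟨i, hi⟩ := X.exists_mem_Icc_piece h.one_le_τ (hsub ht)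
    have hφ := h.phi_mem (hsub ht)
    obtain ⟨a, ha⟩ := Finite.exists_max fun ρ => X.pos ρ t
    obtain ⟨b, hb⟩ := Finite.exists_min fun ρ => X.pos ρ t
    have hle : ∀ ρ ρ' : Fin n, X.pos ρ t ≤ X.pos ρ' t →
        line p k x ρ (φ t) ≤ line p k x ρ' (φ t) := fun ρ ρ' hρ => by
      rw [h.pos_eq, h.pos_eq] at hρ
      exact le_of_mul_le_mul_left hρ h.eps_pos
    have hp2 : (1 : ℝ) ≤ (p : ℝ) ^ 2 := by
      exact_mod_cast Nat.one_le_pow 2 p h.one_le_p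
    have hp := h.one_le_p
    have hcard := h.card_eq
    have h0 := line_top_mem hφ h.one_le_k h.shift_mem (i := 0) (by omega)
    have h1 := line_bottom_mem hφ h.one_le_k h.shift_mem (j := 0) (by omega)
    have ha0 := hle _ _ (ha ⟨0, by omega⟩)
    have hb0 := hle _ _ (hb ⟨p + 0, by omega⟩)
    have hap : (a : ℕ) < p := by
      rcases cases_index (h.lt_card a) with h' | ⟨j, hj, hj'⟩ | ⟨l, hl, hl'⟩
      · exact h'
      · rw [hj'] at ha0
        linarith [h0.1, (line_bottom_mem hφ h.one_le_k h.shift_mem hj).2]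
      · rw [hl'] at ha0
        linarith [h0.1, (line_mid_mem_unit h.one_le_p hφ h.shift_mem hl).2]
    have hbp : ∃ j < p, (b : ℕ) = p + j := by
      rcases cases_index (h.lt_card b) with h' | h' | ⟨l, hl, hl'⟩
      · linarith [h1.2, (line_top_mem hφ h.one_le_k h.shift_mem h').1]
      · exact h'
      · rw [hl'] at hb0
        linarith [h1.2, (line_mid_mem_unit h.one_le_p hφ h.shift_mem hl).1]
    obtain ⟨hconn, hσ, hψ⟩ := hcon t ht
    have heq : X.farDist σ t = X.farDist ψ t :=
      le_antisymm (hσ ψ hconn) (hψ σ hconn.symm)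
    have hprod : X.pos σ t = X.pos ψ t ∨
        X.pos σ t + X.pos ψ t = X.pos a t + X.pos b t := by
      rw [farDist_eq_max ha hb, farDist_eq_max ha hb] at heq
      rcases max_choice (X.pos a t - X.pos σ t) (X.pos σ t - X.pos b t) with e | e <;>
        rcases max_choice (X.pos a t - X.pos ψ t) (X.pos ψ t - X.pos b t) with e' | e' <;>
        rw [e, e'] at heq
      · left; linarith
      · right; linarith
      · right; linarith
      · left; linarith
    rcases hprod with he | he
    · refine ⟨(i, none), hi, ?_⟩
      exact le_antisymm (hle _ _ he.le) (hle _ _ he.ge)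
    · refine ⟨(i, some (a, b)), hi, hap, hbp, ?_⟩
      simp only [h.pos_eq, ← mul_add] at he
      exact mul_left_cancel₀ h.eps_pos.ne' he
  choose lab hlab using hlab
  have : Infinite (Icc u v) := (Icc_infinite huv).to_subtype
  obtain ⟨t, t', hne, heq⟩ := Finite.exists_ne_map_eq_of_infinite lab
  obtain ⟨hi, hrel⟩ := hlab t
  obtain ⟨hi', hrel'⟩ := hlab t'
  rw [← heq] at hi' hrel'
  have hφne : φ t ≠ φ t' := by
    intro he
    refine hne (Subtype.ext ?_)
    rcases h.zigzag.strict (lab t).1 with hs | hs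
    · exact hs.injOn hi hi' he
    · exact hs.injOn hi hi' he
  rcases hl : (lab t).2 with _ | ⟨a, b⟩
  · rw [hl] at hrel hrel'
    simp only [line] at hrel hrel'
    refine hslope (mul_right_cancel₀ (sub_ne_zero.2 hφne) ?_)
    linarith
  · rw [hl] at hrel hrel'
    obtain ⟨ha, ⟨j, hj, hb⟩, hrel⟩ := hrel
    obtain ⟨-, -, hrel'⟩ := hrel'
    rw [hb] at hrel hrel'
    refine slope_add_ne h.one_le_p (h.lt_card σ) (h.lt_card ψ) hkind ha hj ?_
    simp only [line] at hrel hrel'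
    refine mul_right_cancel₀ (sub_ne_zero.2 hφne) ?_
    linarith

/-- The middle entities are pairwise `ε`-connected and better than all others, so a trajectoid may
always be on the best entity; a central trajectory is, where that entity is unique. -/
theorem eventually_eq_mid (h : X.IsZigzagMotion ε p k x φ) (hc : X.IsCentral ε c) {i l : ℕ}
    (hi : i < p) (hl : l < k) {t : ℝ} (ht : t ∈ Ioo X.start X.finish) (hφ : φ t = sample k i l) :
    ∀ᶠ s in 𝓝 t, c s = h.mid l hl := by
  have hτ := h.one_le_τ
  have hn : 1 ≤ n := by have := h.card_eq; have := h.one_le_p; omega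
  obtain ⟨G, hG, -⟩ := X.exists_isSteadyCut ε hn hτ
  have hk : 0 < k := h.one_le_k
  obtain ⟨c', hc', hb⟩ :=
    (isTrajectoid_const (X := X) (ε := ε) (h.mid 0 hk)).exists_followsBest hτ hG
  have hbest : ∀ t ∈ Ioo X.start X.finish, t ∉ G → ∀ ρ, X.farDist (c' t) t ≤ X.farDist ρ t := by
    intro t ht htG ρ
    have htI := Ioo_subset_Icc_self ht
    rcases lt_or_ge (ρ : ℕ) (2 * p) with hρ | hρ
    · exact (hb.farDist_le hG ht htG (.refl _)).trans (h.farDist_mid_le hk htI hρ)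
    · have hρ' := h.lt_card ρ
      have : ρ = h.mid (ρ - 2 * p) (by omega) := Fin.ext (by simp only [mid]; omega)
      rw [this]
      exact hb.farDist_le hG ht htG (h.mid_connected hk _ htI)
  have hmem : Icc X.start X.finish ∈ 𝓝 t := Icc_mem_nhds ht.1 ht.2
  have hev : ∀ᶠ s in 𝓝 t, ∀ ρ, ρ ≠ h.mid l hl → X.farDist (h.mid l hl) s < X.farDist ρ s := by
    rw [eventually_all]
    intro ρ
    rw [eventually_imp_distrib_left]
    intro hρ
    exact ((X.continuousOn_farDist hτ _).continuousAt hmem).eventually_lt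
      ((X.continuousOn_farDist hτ ρ).continuousAt hmem) (h.farDist_lt_of_sample hi hl hφ hρ)
  obtain ⟨u, v, htuv, hsub⟩ := mem_nhds_iff_exists_Ioo_subset.1
    (inter_mem hev (Ioo_mem_nhds ht.1 ht.2))
  have hle := (Ioo_subset_Ioo_iff (htuv.1.trans htuv.2)).1 fun s hs => (hsub hs).2
  refine mem_of_superset (Ioo_mem_nhds htuv.1 htuv.2)
    (hc.1.eq_of_forall_subinterval hle.1 hle.2 fun ρ u' v' hu' huv' hv' hρ => ?_)
  by_contra hne
  obtain ⟨s, hs, hsG, heq⟩ := exists_farDist_eq hτ hc.1 hc'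
    (fun t ht htG => hbest t ht htG _) (hc.2 c' hc') (hle.1.trans hu') huv' (hv'.trans hle.2)
  have hs' := hsub (show s ∈ Ioo u v from ⟨hu'.trans_lt hs.1, hs.2.trans_le hv'⟩)
  rw [hρ s hs] at heq
  have h1 := hbest s hs'.2 hsG (h.mid l hl)
  have h2 := hs'.1 ρ hne
  linarith

end IsZigzagMotion

/-- A trajectoid with different values at two times jumps between them. -/
theorem exists_mem_jumpTimes {t t' : ℝ} (ht : X.start < t) (ht' : t' < X.finish) (hlt : t ≤ t')
    (hne : c t ≠ c t') : ∃ r ∈ Icc t t', r ∈ X.jumpTimes c := by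
  by_contra! hcon
  refine hne ((isPreconnected_Icc (a := t) (b := t')).induction₂ (fun s r => c s = c r) ?_ ?_ ?_
    ⟨le_rfl, hlt⟩ ⟨hlt, le_rfl⟩)
  · intro s hs
    have hev : ∀ᶠ r in 𝓝 s, c r = c s := by
      by_contra hj
      exact hcon s hs ⟨⟨ht.trans_le hs.1, hs.2.trans_lt ht'⟩, hj⟩
    exact mem_nhdsWithin_of_mem_nhds (hev.mono fun r hr => hr.symm)
  · exact fun _ _ _ _ _ _ h1 h2 => h1.trans h2
  · exact fun _ _ _ _ h1 => h1.symm

namespace IsZigzagMotion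

open ZigzagLines

variable {p k : ℕ} {x : ℕ → ℝ} {φ : ℝ → ℝ}

theorem exists_jump (h : X.IsZigzagMotion ε p k x φ) (hc : X.IsCentral ε c) (m : Fin τ) {i l : ℕ}
    (hi : i < p) (hl : l + 1 < k) : ∃ r ∈ X.jumpTimes c,
      r ∈ Ioo (X.time m.castSucc) (X.time m.succ) ∧
        φ r ∈ Ioo (sample k i (l + 1)) (sample k i l) := by
  have hsample : ∀ l < k, sample k i l ∈ Ioo (0 : ℝ) (2 * p) := fun l hl => by
    have h1 := sample_mem (i := i) hl
    have h2 : (i : ℝ) + 1 ≤ p := by exact_mod_cast hi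
    have h3 : (0 : ℝ) ≤ i := i.cast_nonneg
    exact ⟨by linarith [h1.1], by linarith [h1.2]⟩
  obtain ⟨t, ht, hφt⟩ := h.zigzag.surj m _ (hsample l (by omega))
  obtain ⟨t', ht', hφt'⟩ := h.zigzag.surj m _ (hsample (l + 1) hl)
  have hsub : Ioo (X.time m.castSucc) (X.time m.succ) ⊆ Ioo X.start X.finish :=
    Ioo_subset_Ioo (X.time_strictMono.monotone (Fin.zero_le _))
      (X.time_strictMono.monotone (Fin.le_last _))
  have hct := h.eventually_eq_mid hc hi (by omega) (hsub ht) hφt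
  have hct' := h.eventually_eq_mid hc hi hl (hsub ht') hφt'
  have hne : c t ≠ c t' := by
    rw [hct.self_of_nhds, hct'.self_of_nhds]
    intro he
    simpa [mid] using congrArg Fin.val he
  have hnt : t ∉ X.jumpTimes c := fun hj => hj.2 (by rw [hct.self_of_nhds]; exact hct)
  have hnt' : t' ∉ X.jumpTimes c := fun hj => hj.2 (by rw [hct'.self_of_nhds]; exact hct')
  -- the jump lies between the two times, on either of the two legs of the zigzag
  obtain ⟨r, hr, hrj⟩ : ∃ r, (r ∈ Ioo t t' ∨ r ∈ Ioo t' t) ∧ r ∈ X.jumpTimes c := by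
    rcases le_total t t' with hle | hle
    · obtain ⟨r, hr, hrj⟩ := exists_mem_jumpTimes (hsub ht).1 (hsub ht').2 hle hne
      exact ⟨r, Or.inl ⟨hr.1.lt_of_ne (by rintro rfl; exact hnt hrj),
        hr.2.lt_of_ne (by rintro rfl; exact hnt' hrj)⟩, hrj⟩
    · obtain ⟨r, hr, hrj⟩ := exists_mem_jumpTimes (hsub ht').1 (hsub ht).2 hle hne.symm
      exact ⟨r, Or.inr ⟨hr.1.lt_of_ne (by rintro rfl; exact hnt' hrj),
        hr.2.lt_of_ne (by rintro rfl; exact hnt hrj)⟩, hrj⟩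
  have hrm : r ∈ Ioo (X.time m.castSucc) (X.time m.succ) := by
    rcases hr with hr | hr
    · exact ⟨ht.1.trans hr.1, hr.2.trans ht'.2⟩
    · exact ⟨ht'.1.trans hr.1, hr.2.trans ht.2⟩
  have hlt : sample k i (l + 1) < sample k i l := by
    have hk : (0 : ℝ) < k := by exact_mod_cast (by omega : 0 < k)
    rw [sample, sample]
    push_cast
    have : (2 * (l : ℝ) + 1) / (2 * k) < (2 * (l + 1) + 1) / (2 * k) := by gcongr; linarith
    linarith
  refine ⟨r, hrj, hrm, ?_⟩
  have hI := Ioo_subset_Icc_self (a := X.time m.castSucc) (b := X.time m.succ)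
  rw [← hφt, ← hφt'] at hlt ⊢
  rcases h.zigzag.strict m with hs | hs
  · have htt : t' < t := (hs.lt_iff_lt (hI ht') (hI ht)).1 hlt
    rcases hr with hr | hr
    · exact absurd (hr.1.trans hr.2) (not_lt.2 htt.le)
    · exact ⟨hs (hI ht') (hI hrm) hr.1, hs (hI hrm) (hI ht) hr.2⟩
  · have htt : t < t' := (hs.lt_iff_gt (hI ht') (hI ht)).1 hlt
    rcases hr with hr | hr
    · exact ⟨hs (hI hrm) (hI ht') hr.2, hs (hI ht) (hI hrm) hr.1⟩
    · exact absurd (hr.1.trans hr.2) (not_lt.2 htt.le)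

theorem le_complexity (h : X.IsZigzagMotion ε p k x φ) (hc : X.IsCentral ε c) :
    ((τ * (p * (k - 1)) : ℕ) : ℕ∞) ≤ X.complexity c := by
  have hex : ∀ q : Fin τ × Fin p × Fin (k - 1), ∃ r ∈ X.jumpTimes c,
      r ∈ Ioo (X.time q.1.castSucc) (X.time q.1.succ) ∧
        φ r ∈ Ioo (sample k q.2.1 (q.2.2 + 1)) (sample k q.2.1 q.2.2) := fun q =>
    h.exists_jump hc q.1 q.2.1.2 (by have := q.2.2.2; omega)
  choose f hfj hfm hfφ using hex
  have hpiece : ∀ q q', q.1 < q'.1 → f q ≠ f q' := by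
    intro q q' hlt he
    have h1 : q.1.succ ≤ q'.1.castSucc := by
      rw [Fin.le_def, Fin.val_succ, Fin.val_castSucc]
      exact hlt
    have h2 := (hfm q).2.trans_le (X.time_strictMono.monotone h1)
    rw [he] at h2
    exact absurd (hfm q').1 (not_lt.2 h2.le)
  have hleg : ∀ q q', q.2.1 < q'.2.1 → f q ≠ f q' := by
    intro q q' hlt he
    have hq := q.2.2.2
    have hq' := q'.2.2.2
    have h1 := (hfφ q).2.trans (sample_mem (k := k) (i := q.2.1) (l := q.2.2) (by omega)).2
    have h2 := (sample_mem (k := k) (i := q'.2.1) (l := q'.2.2 + 1) (by omega)).1.trans (hfφ q').1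
    rw [he] at h1
    have h3 : ((q.2.1 : ℕ) : ℝ) + 1 ≤ ((q'.2.1 : ℕ) : ℝ) := by exact_mod_cast hlt
    linarith
  have hlevel : ∀ q q', q.2.1 = q'.2.1 → q.2.2 < q'.2.2 → f q ≠ f q' := by
    intro q q' heq hlt he
    have h1 := (hfφ q).1
    have h2 := (hfφ q').2
    rw [he, heq] at h1
    have hq := q.2.2.2
    have hk : (0 : ℝ) < k := by exact_mod_cast (by omega : 0 < k)
    have h3 : ((q.2.2 : ℕ) : ℝ) + 1 ≤ ((q'.2.2 : ℕ) : ℝ) := by exact_mod_cast hlt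
    have h4 : (2 * (((q.2.2 : ℕ) : ℝ) + 1) + 1) / (2 * k) ≤
        (2 * ((q'.2.2 : ℕ) : ℝ) + 1) / (2 * k) := by gcongr
    have h5 := h1.trans h2
    rw [sample, sample] at h5
    push_cast at h5
    linarith
  have hinj : Function.Injective f := by
    intro q q' he
    have e1 : q.1 = q'.1 := by
      rcases lt_trichotomy q.1 q'.1 with hlt | heq | hlt
      · exact absurd he (hpiece q q' hlt)
      · exact heq
      · exact absurd he.symm (hpiece q' q hlt)
    have e2 : q.2.1 = q'.2.1 := by
      rcases lt_trichotomy q.2.1 q'.2.1 with hlt | heq | hlt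
      · exact absurd he (hleg q q' hlt)
      · exact heq
      · exact absurd he.symm (hleg q' q hlt)
    have e3 : q.2.2 = q'.2.2 := by
      rcases lt_trichotomy q.2.2 q'.2.2 with hlt | heq | hlt
      · exact absurd he (hlevel q q' e2 hlt)
      · exact heq
      · exact absurd he.symm (hlevel q' q e2.symm hlt)
    exact Prod.ext e1 (Prod.ext e2 e3)
  have hcard : ((τ * (p * (k - 1)) : ℕ) : ℕ∞) ≤ (range f).encard := by
    refine le_trans ?_ hinj.encard_range
    rw [ENat.card_eq_coe_fintype_card]
    simp
  refine hcard.trans ?_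
  refine encard_le_encard (subset_trans ?_ subset_union_right)
  rintro _ ⟨q, rfl⟩
  exact hfj q

end IsZigzagMotion

open ZigzagLines in
theorem exists_isZigzagMotion {p k : ℕ} (hn : n = 2 * p + k) (hp : 1 ≤ p) (hk : 1 ≤ k)
    (hτ : 1 ≤ τ) (hε : 0 < ε) {time : Fin (τ + 1) → ℝ} (htime : StrictMono time) :
    ∃ (X : MovingEntities n τ) (x : ℕ → ℝ) (φ : ℝ → ℝ), X.time = time ∧ X.GeneralPosition ε ∧
      X.IsZigzagMotion ε p k x φ := by
  have hk' : (0 : ℝ) < k := by exact_mod_cast hk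
  have hp' : (0 : ℝ) < p := by exact_mod_cast hp
  obtain ⟨x, hx, hthree, hpairs⟩ := exists_shift_generalPosition (intercept p k) (slope p k)
    (n := n) (δ := 1 / (16 * k)) (by positivity) (by rw [hn]; exact slope_injOn hp)
  obtain ⟨φ, hφ⟩ := exists_isZigzag htime (S := 2 * p) (by positivity)
  let X : MovingEntities n τ :=
    { time := time
      time_strictMono := htime
      pos := fun σ t => ε * line p k x σ (φ t)
      linear_on_pieces := fun σ i => by
        obtain ⟨α, β, h⟩ := hφ.affine i
        refine ⟨ε * (intercept p k σ + x σ + slope p k σ * α), ε * (slope p k σ * β),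
          fun t ht => ?_⟩
        rw [h t ht, line]
        ring }
  have hX : X.IsZigzagMotion ε p k x φ := ⟨hn, hp, hk, hτ, hε, hx, hφ, fun _ _ => rfl⟩
  refine ⟨X, x, φ, rfl, ⟨?_, ?_⟩, hX⟩
  · have hlt : ∀ t, ∀ σ ψ ρ : Fin n, σ < ψ → ψ < ρ →
        ¬ (X.pos σ t = X.pos ψ t ∧ X.pos ψ t = X.pos ρ t) := by
      rintro t σ ψ ρ h1 h2 ⟨e1, e2⟩
      exact hthree (φ t) σ ψ ρ h1 h2 ρ.2
        ⟨mul_left_cancel₀ hε.ne' e1, mul_left_cancel₀ hε.ne' e2⟩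
    rintro t - σ ψ ρ h1 h2 h3 ⟨e1, e2⟩
    rcases lt_or_gt_of_ne h1 with h1 | h1 <;> rcases lt_or_gt_of_ne h2 with h2 | h2 <;>
      rcases lt_or_gt_of_ne h3 with h3 | h3
    · exact hlt t _ _ _ h1 h2 ⟨e1, e2⟩
    · exact hlt t _ _ _ h1 h2 ⟨e1, e2⟩
    · exact hlt t _ _ _ h3 h2 ⟨e1.trans e2, e2.symm⟩
    · exact hlt t _ _ _ h3 h1 ⟨(e1.trans e2).symm, e1⟩
    · exact hlt t _ _ _ h1 h3 ⟨e1.symm, e1.trans e2⟩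
    · exact hlt t _ _ _ h2 h3 ⟨e2, (e1.trans e2).symm⟩
    · exact hlt t _ _ _ h2 h1 ⟨e2.symm, e1.symm⟩
    · exact hlt t _ _ _ h2 h1 ⟨e2.symm, e1.symm⟩
  · have hord : ∀ t, ∀ σ ψ : Fin n, σ ≠ ψ → |X.pos σ t - X.pos ψ t| = ε →
        ∃ a b : Fin n, a < b ∧ s(σ, ψ) = s(a, b) ∧
          |line p k x a (φ t) - line p k x b (φ t)| = 1 := by
      intro t σ ψ hne h
      rw [hX.abs_sub_eq, mul_eq_left₀ hε.ne'] at h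
      rcases lt_or_gt_of_ne hne with hlt | hlt
      · exact ⟨σ, ψ, hlt, rfl, h⟩
      · exact ⟨ψ, σ, hlt, Sym2.eq_swap, by rwa [abs_sub_comm]⟩
    rintro t - σ ψ σ' ψ' h1 h2 e1 e2
    obtain ⟨a, b, hab, hs, h⟩ := hord t σ ψ h1 e1
    obtain ⟨a', b', hab', hs', h'⟩ := hord t σ' ψ' h2 e2
    obtain ⟨ha, hb⟩ := hpairs (φ t) a b a' b' hab b.2 hab' b'.2 h h'
    rw [hs, hs', Fin.ext ha, Fin.ext hb]

theorem lower_bound (hn : 6 ≤ n) (hτ : 1 ≤ τ) (hε : 0 < ε) {time : Fin (τ + 1) → ℝ}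
    (htime : StrictMono time) :
    ∃ X : MovingEntities n τ, X.time = time ∧ X.GeneralPosition ε ∧ X.NoPersistentTies ε ∧
      ∀ c : ℝ → Fin n, X.IsCentral ε c →
        ((τ * n ^ 2 : ℕ) : ℕ∞) ≤ ((32 : ℕ) : ℕ∞) * X.complexity c := by
  obtain ⟨X, x, φ, htimeX, hgen, hX⟩ := exists_isZigzagMotion (n := n) (p := n / 3)
    (k := n - 2 * (n / 3)) (by omega) (by omega) (by omega) hτ hε htime
  refine ⟨X, htimeX, hgen, hX.noPersistentTies, fun c hc => ?_⟩
  refine le_trans ?_ (mul_le_mul_right (hX.le_complexity hc) _)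
  have key : n ^ 2 ≤ 32 * (n / 3 * (n - 2 * (n / 3) - 1)) := by
    obtain ⟨p, hp⟩ : ∃ p, p = n / 3 := ⟨_, rfl⟩
    obtain ⟨q, hq⟩ : ∃ q, q = n - 2 * (n / 3) - 1 := ⟨_, rfl⟩
    rw [← hq, ← hp]
    have h1 : n ≤ 4 * p := by omega
    have h2 : p ≤ 2 * q := by omega
    calc n ^ 2 ≤ (4 * p) ^ 2 := Nat.pow_le_pow_left h1 2
      _ = 16 * (p * p) := by ring
      _ ≤ 16 * (p * (2 * q)) := by gcongr
      _ = 32 * (p * q) := by ring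
  have key' : τ * n ^ 2 ≤ 32 * (τ * (n / 3 * (n - 2 * (n / 3) - 1))) := by
    calc τ * n ^ 2 ≤ τ * (32 * (n / 3 * (n - 2 * (n / 3) - 1))) := Nat.mul_le_mul_left _ key
      _ = _ := by ring
  exact_mod_cast key'

end MovingEntities

theorem mainTheorem1 :
    (∃ C : ℕ, ∀ n τ : ℕ, 1 ≤ n → 1 ≤ τ → ∀ (X : MovingEntities n τ) (ε : ℝ), 0 ≤ ε →
      (∃ c : ℝ → Fin n, X.IsCentral ε c ∧ X.complexity c ≤ ((C * τ * n ^ 2 : ℕ) : ℕ∞)) ∧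
      (X.NoPersistentTies ε → ∀ c : ℝ → Fin n, X.IsCentral ε c →
        X.complexity c ≤ ((C * τ * n ^ 2 : ℕ) : ℕ∞))) ∧
    (∃ K N : ℕ, ∀ n τ : ℕ, N ≤ n → 1 ≤ τ → ∀ ε : ℝ, 0 < ε →
      ∀ time : Fin (τ + 1) → ℝ, StrictMono time →
        ∃ X : MovingEntities n τ, X.time = time ∧ X.GeneralPosition ε ∧ X.NoPersistentTies ε ∧
          ∀ c : ℝ → Fin n, X.IsCentral ε c →
            ((τ * n ^ 2 : ℕ) : ℕ∞) ≤ (K : ℕ∞) * X.complexity c) :=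
  ⟨⟨174, fun _ _ hn hτ X ε _ => MovingEntities.upper_bound hn hτ X ε⟩,
    ⟨32, 6, fun _ _ hn hτ _ hε _ htime => MovingEntities.lower_bound hn hτ hε htime⟩⟩
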